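/- **Setting.** Let $B_1,\dots,B_D$ be blocks; the block $B_d$ is a finite sequence of $\mathrm{len}(B_d)\ge 1$ resonators, each given by a wave speed $v>0$, a length $\ell>0$ and a spacing $s>0$ to its right neighbour. Let $p_1,\dots,p_D\ge 0$ with $\sum_d p_d=1$. Let $R=\{(d,r): 1\le d\le D,\ 1\le r\le \mathrm{len}(B_d)\}$. A block sequence $\chi\in\{1,\dots,D\}^{\mathbb Z}$ determines the resonator sequence $\Phi(\chi)=(\dots,(\chi_0,1),\dots,(\chi_0,\mathrm{len}(B_{\chi_0})),(\chi_1,1),\dots)\in R^{\mathbb Z}$, in which $(\chi_0,1)$ has position $0$. A sequence $\mu\in R^{\mathbb Z}$ has wave speeds $v_i$, lengths $\ell_i$ and spacings $s_i$, $i\in\mathbb Z$, and defines the bounded self-adjoint Jacobi operator on $\ell^2(\mathbb Z)$ $$(J(\mu)u)^{(i)}=-\mathbf s^{(i)}u^{(i-1)}+\mathbf q^{(i)}u^{(i)}-\mathbf s^{(i+1)}u^{(i+1)},\qquad \mathbf s^{(i)}=\frac{v_{i-1}v_i}{s_{i-1}\sqrt{\ell_{i-1}\ell_i}},\quad \mathbf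 q^{(i)}=\frac{v_i^2}{\ell_i}\Big(\frac1{s_{i-1}}+\frac1{s_i}\Big).$$ Let $J_K=(J_{i,j})_{|i|,|j|\le K}$, and let $N_K(J_K,\cdot)$ be the measure $S\mapsto \frac1{2K+1}|\sigma(J_K)\cap S|$ on $\mathbb R$. Let $E_J$ be the resolution of the identity of $J$ and $(e_i)_{i\in\mathbb Z}$ the standard basis of $\ell^2(\mathbb Z)$. Let $\mathbb P$ be the law of an i.i.d. sequence $\chi\in\{1,\dots,D\}^{\mathbb Z}$ with $\mathbb P(\chi_i=d)=p_d$, and let $\mathbb P_R$ be the law on $R^{\mathbb Z}$ of the stationary (shift-invariant) resonator sequence built from i.i.d. blocks, i.e. of the stationary bi-infinite Markov chain on $R$ in which $(d,r)$ is followed by $(d,r+1)$ if $r<\mathrm{len}(B_d)$, and by $(d',1)$ with probability $p_{d'}$ if $r=\mathrm{len}(B_d)$; explicitly, with $m=\sum_d p_d\,\mathrm{len}(B_d)$, $$\mathbb P_R(A)=\frac1m\sum_{(d,r)\in R}\mathbb P\big(\chi_0=d,\ (\Phi(\chi)_{i+r-1})_{i\in\mathbb Z}\in A\big).$$ **Theorem.**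 There is a non-random Borel probability measure $N(J,d\lambda)$ on $\mathbb R$ such that 1. for $\mathbb P_R$-almost every $\mu$, with $J=J(\mu)$, and likewise for $\mathbb P$-almost every $\chi$, with $J=J(\Phi(\chi))$, the measures $N_K(J_K,d\lambda)$ converge weakly to $N(J,d\lambda)$ as $K\to\infty$; 2. $N(J,S)=\mathbb E_{\mathbb P_R}\langle e_0,E_{J(\mu)}(S)e_0\rangle$ for every Borel set $S\subseteq\mathbb R$ (the integrand being $\mathbb P_R$-a.e. measurable in $\mu$); 3. the integrated density of states $\lambda\mapsto N(J,\lambda)=N(J,(-\infty,\lambda])$ is continuous. -/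

import Mathlib

open MeasureTheory Filter Topology
open scoped ENNReal BoundedContinuousFunction InnerProductSpace

namespace BlockJacobi

/-! ### Block systems and resonator sequences -/

/-- A resonator: its wave speed `v`, its length `ℓ`, and the spacing `s` that separates it from the
next resonator to its right. -/
structure Resonator where
  speed : ℝ
  length : ℝ
  spacing : ℝ
  speed_pos : 0 < speed
  length_pos : 0 < length
  spacing_pos : 0 < spacing

/-- A selection of `D` blocks; the block `d` consists of `len d ≥ 1` resonators. -/
structure BlockSystem (D : ℕ) where
  len : Fin D → ℕ
  len_pos : ∀ d, 0 < len d
  res : ∀ d, Fin (len d) → Resonator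

variable {D : ℕ}

/-- The finite set `R` of pairs `(d, r)`: the `r`-th resonator (counted from zero) of block `d`. -/
abbrev BlockSystem.Index (B : BlockSystem D) : Type := Σ d : Fin D, Fin (B.len d)

/-- Given a block sequence `χ`, the places `(j, r)` of the resonators of the infinite array: the
`r`-th resonator of the `j`-th block. -/
abbrev Place (B : BlockSystem D) (χ : ℤ → Fin D) : Type := {x : ℤ × ℕ // x.2 < B.len (χ x.1)}

/-- The passage from a resonator of the array to its right neighbour, as a permutation of the
places; the inverse is the passage to the left neighbour. -/
def nextPlace (B : BlockSystem D) (χ : ℤ → Fin D) : Equiv.Perm (Place B χ) where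
  toFun x :=
    if h : x.1.2 + 1 < B.len (χ x.1.1) then ⟨(x.1.1, x.1.2 + 1), h⟩
    else ⟨(x.1.1 + 1, 0), B.len_pos _⟩
  invFun x :=
    if 0 < x.1.2 then ⟨(x.1.1, x.1.2 - 1), lt_of_le_of_lt (Nat.sub_le _ _) x.2⟩
    else ⟨(x.1.1 - 1, B.len (χ (x.1.1 - 1)) - 1), Nat.sub_lt (B.len_pos _) one_pos⟩
  left_inv := by
    rintro ⟨⟨j, r⟩, hr⟩
    by_cases h : r + 1 < B.len (χ j)
    · simp [h]
    · simp only at hr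
      have h2 : r = B.len (χ j) - 1 := by omega
      have h3 := B.len_pos (χ j)
      have h4 : ¬ B.len (χ j) - 1 + 1 < B.len (χ j) := by omega
      simp [h2, h4]
  right_inv := by
    rintro ⟨⟨j, r⟩, hr⟩
    simp only at hr
    by_cases h : 0 < r
    · have h1 : r - 1 + 1 = r := by omega
      simp [h, h1, hr]
    · have h1 := B.len_pos (χ (j - 1))
      have h2 : B.len (χ (j - 1)) - 1 + 1 = B.len (χ (j - 1)) := by omega
      simp [h, h2]
      omega

/-- The place of the `i`-th resonator of the array; the resonator with number `0` is the first
resonator of the block with number `0`. -/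
def placeOf (B : BlockSystem D) (χ : ℤ → Fin D) (i : ℤ) : Place B χ :=
  (nextPlace B χ ^ i) ⟨(0, 0), B.len_pos _⟩

/-- The resonator sequence
`Φ χ = (…, (χ 0, first), …, (χ 0, last), (χ 1, first), …)` of a block sequence `χ`. -/
def resonatorSequence (B : BlockSystem D) (χ : ℤ → Fin D) (i : ℤ) : B.Index :=
  ⟨χ (placeOf B χ i).1.1, ⟨(placeOf B χ i).1.2, (placeOf B χ i).2⟩⟩

/-- The shift `(T_k μ) i = μ (i + k)`. -/
def shift {α : Type*} (k : ℤ) (μ : ℤ → α) : ℤ → α := fun i => μ (i + k)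

/-! ### Probability -/

/-- The law of a bi-infinite i.i.d. sequence of blocks with block probabilities `p`. -/
noncomputable def blockLaw (p : PMF (Fin D)) : Measure (ℤ → Fin D) :=
  Measure.infinitePi fun _ : ℤ => p.toMeasure

/-- The mean number `∑ d, p d * len d` of resonators of a random block. -/
noncomputable def meanLength (B : BlockSystem D) (p : PMF (Fin D)) : ℝ≥0∞ :=
  ∑ d, p d * (B.len d : ℝ≥0∞)

/-- The law of the stationary (shift-invariant) sequence of resonators built from i.i.d. blocks:
the origin is placed at the resonator `(d, r)` with probability `p d / ∑ d', p d' * len d'`, and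
given this, all blocks other than the one containing the origin are i.i.d. with law `p`. This is
the law of the stationary bi-infinite Markov chain on `R` in which `(d, r)` is followed by
`(d, r + 1)` if this is a resonator of `d`, and by the first resonator of `d'` with probability
`p d'` otherwise. -/
noncomputable def resonatorLaw (B : BlockSystem D) (p : PMF (Fin D)) : Measure (ℤ → B.Index) :=
  (meanLength B p)⁻¹ • ∑ a : B.Index,
    ((blockLaw p).restrict {χ | χ 0 = a.1}).map
      fun χ => shift ((a.2 : ℕ) : ℤ) (resonatorSequence B χ)

theorem measurable_place (B : BlockSystem D) (i : ℤ) :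
    Measurable fun χ : ℤ → Fin D => (placeOf B χ i).1 := by
  have key : ∀ (G : (ℤ × ℕ) → (ℤ → Fin D) → ℤ × ℕ), (∀ x, Measurable (G x)) →
      ∀ f : (ℤ → Fin D) → ℤ × ℕ, Measurable f → Measurable fun χ => G (f χ) χ := by
    intro G hG f hf
    have : Measurable fun y : (ℤ → Fin D) × (ℤ × ℕ) => G y.2 y.1 :=
      measurable_from_prod_countable_left hG
    exact this.comp (measurable_id.prodMk hf)
  induction i using Int.induction_on with
  | zero => simp [placeOf]
  | succ i ih =>
    have : (fun χ : ℤ → Fin D => (placeOf B χ (i + 1)).1) = fun χ =>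
        (fun (x : ℤ × ℕ) (χ : ℤ → Fin D) =>
          if x.2 + 1 < B.len (χ x.1) then (x.1, x.2 + 1) else (x.1 + 1, 0)) (placeOf B χ i).1 χ := by
      funext χ
      have : placeOf B χ (i + 1) = nextPlace B χ (placeOf B χ i) := by
        rw [placeOf, add_comm, zpow_add, zpow_one]; rfl
      rw [this]
      simp only [nextPlace, Equiv.coe_fn_mk]
      split_ifs <;> rfl
    rw [this]
    refine key (fun (x : ℤ × ℕ) (χ : ℤ → Fin D) =>
      if x.2 + 1 < B.len (χ x.1) then (x.1, x.2 + 1) else (x.1 + 1, 0)) (fun x => ?_) _ ih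
    exact (Measurable.of_discrete (f := fun d : Fin D =>
      if x.2 + 1 < B.len d then (x.1, x.2 + 1) else (x.1 + 1, 0))).comp (measurable_pi_apply x.1)
  | pred i ih =>
    have : (fun χ : ℤ → Fin D => (placeOf B χ (-i - 1)).1) = fun χ =>
        (fun (x : ℤ × ℕ) (χ : ℤ → Fin D) =>
          if 0 < x.2 then (x.1, x.2 - 1) else (x.1 - 1, B.len (χ (x.1 - 1)) - 1))
          (placeOf B χ (-i)).1 χ := by
      funext χ
      have : placeOf B χ (-i - 1) = (nextPlace B χ).symm (placeOf B χ (-i)) := by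
        rw [placeOf, sub_eq_neg_add, zpow_add, zpow_neg_one]; rfl
      rw [this]
      simp only [nextPlace, Equiv.coe_fn_symm_mk]
      split_ifs <;> rfl
    rw [this]
    refine key (fun (x : ℤ × ℕ) (χ : ℤ → Fin D) =>
      if 0 < x.2 then (x.1, x.2 - 1) else (x.1 - 1, B.len (χ (x.1 - 1)) - 1)) (fun x => ?_) _ ih
    exact (Measurable.of_discrete (f := fun d : Fin D =>
      if 0 < x.2 then (x.1, x.2 - 1) else (x.1 - 1, B.len d - 1))).comp
        (measurable_pi_apply (x.1 - 1))

theorem measurable_resonatorSequence (B : BlockSystem D) : Measurable (resonatorSequence B) := by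
  refine measurable_pi_iff.2 fun i => ?_
  refine measurable_to_countable' fun a => ?_
  have h := measurable_place B i
  have : (fun χ : ℤ → Fin D => resonatorSequence B χ i) ⁻¹' {a} =
      ⋃ j : ℤ, {χ | (placeOf B χ i).1 = (j, (a.2 : ℕ))} ∩ {χ | χ j = a.1} := by
    ext χ
    obtain ⟨d, r⟩ := a
    simp only [Set.mem_preimage, Set.mem_singleton_iff, Set.mem_iUnion, Set.mem_inter_iff,
      Set.mem_ofPred_eq, resonatorSequence]
    constructor
    · intro h
      refine ⟨(placeOf B χ i).1.1, ?_, ?_⟩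
      · obtain ⟨h1, h2⟩ := Sigma.mk.inj_iff.1 h
        refine Prod.ext rfl ?_
        subst h1
        have := eq_of_heq h2
        simp [← this]
      · exact (Sigma.mk.inj_iff.1 h).1
    · rintro ⟨j, h1, rfl⟩
      have h1' : j = (placeOf B χ i).1.1 := by rw [h1]
      have h2' : (r : ℕ) = (placeOf B χ i).1.2 := by rw [h1]
      subst h1'
      congr 1
      exact Fin.ext h2'.symm
  rw [this]
  refine MeasurableSet.iUnion fun j => (h (measurableSet_singleton _)).inter ?_
  exact (measurable_pi_apply (X := fun _ : ℤ => Fin D) j) (measurableSet_singleton a.1)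

theorem measurable_shift {α : Type*} [MeasurableSpace α] (k : ℤ) :
    Measurable (shift k : (ℤ → α) → ℤ → α) :=
  measurable_pi_iff.2 fun i => measurable_pi_apply (i + k)

theorem blockLaw_coord (p : PMF (Fin D)) (j : ℤ) (d : Fin D) :
    blockLaw p {χ | χ j = d} = p d := by
  have h := (measurePreserving_eval_infinitePi (fun _ : ℤ => p.toMeasure) j).measure_preimage
    (measurableSet_singleton d).nullMeasurableSet
  rw [PMF.toMeasure_apply_singleton _ _ (measurableSet_singleton d)] at h
  exact h

instance (p : PMF (Fin D)) : IsProbabilityMeasure (blockLaw p) := by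
  unfold blockLaw; infer_instance

instance (B : BlockSystem D) (p : PMF (Fin D)) : IsProbabilityMeasure (resonatorLaw B p) := by
  constructor
  have h1 : ∀ a : B.Index, (((blockLaw p).restrict {χ | χ 0 = a.1}).map
      fun χ => shift ((a.2 : ℕ) : ℤ) (resonatorSequence B χ)) Set.univ = p a.1 := fun a => by
    have hm : Measurable fun χ => shift ((a.2 : ℕ) : ℤ) (resonatorSequence B χ) :=
      (measurable_shift _).comp (measurable_resonatorSequence B)
    rw [Measure.map_apply hm .univ]
    simp [blockLaw_coord]
  have h2 : ∑ a : B.Index, p a.1 = meanLength B p := by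
    rw [Fintype.sum_sigma]
    simp [meanLength, mul_comm]
  simp only [resonatorLaw, Measure.smul_apply, Measure.finsetSum_apply, h1, h2, smul_eq_mul]
  refine ENNReal.inv_mul_cancel ?_ ?_
  · intro h
    have h3 := p.tsum_coe
    rw [tsum_fintype, Finset.sum_eq_zero] at h3
    · simp at h3
    · intro d _
      have := (Finset.sum_eq_zero_iff.1 h) d (Finset.mem_univ _)
      simpa [(B.len_pos d).ne'] using this
  · exact ENNReal.sum_ne_top.2 fun d _ => ENNReal.mul_ne_top (p.apply_ne_top d) (by simp)

theorem measurePreserving_shift_blockLaw (p : PMF (Fin D)) (k : ℤ) :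
    MeasurePreserving (shift k) (blockLaw p) (blockLaw p) := by
  refine ⟨measurable_shift k, ?_⟩
  refine Measure.eq_infinitePi _ fun s t ht => ?_
  rw [Measure.map_apply (measurable_shift k) (MeasurableSet.pi s.countable_toSet fun i _ => ht i)]
  have : shift k ⁻¹' (Set.pi (s : Set ℤ) t) =
      Set.pi (s.map (Equiv.addRight k).toEmbedding : Finset ℤ) fun i => t (i - k) := by
    ext χ
    simp only [shift, Set.mem_pi, Set.mem_preimage, Finset.coe_map, Set.mem_image, Finset.mem_coe,
      forall_exists_index, and_imp, forall_apply_eq_imp_iff₂]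
    simp
  rw [this, blockLaw, Measure.infinitePi_pi]
  · simp
  · exact fun i _ => ht _

theorem placeOf_add_one (B : BlockSystem D) (χ : ℤ → Fin D) (i : ℤ) :
    placeOf B χ (i + 1) = nextPlace B χ (placeOf B χ i) := by
  rw [placeOf, add_comm, zpow_add, zpow_one]; rfl

theorem placeOf_sub_one (B : BlockSystem D) (χ : ℤ → Fin D) (i : ℤ) :
    placeOf B χ (i - 1) = (nextPlace B χ).symm (placeOf B χ i) := by
  rw [placeOf, sub_eq_neg_add, zpow_add, zpow_neg_one]; rfl

theorem placeOf_natCast (B : BlockSystem D) (χ : ℤ → Fin D) (r : ℕ) (hr : r < B.len (χ 0)) :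
    placeOf B χ r = ⟨(0, r), hr⟩ := by
  induction r with
  | zero => rfl
  | succ r ih =>
    push_cast
    rw [placeOf_add_one, ih (by omega)]
    simp [nextPlace, hr]

theorem placeOf_len (B : BlockSystem D) (χ : ℤ → Fin D) :
    placeOf B χ (B.len (χ 0)) = ⟨(1, 0), B.len_pos _⟩ := by
  have h := B.len_pos (χ 0)
  obtain ⟨n, hn⟩ : ∃ n, B.len (χ 0) = n + 1 := ⟨B.len (χ 0) - 1, by omega⟩
  rw [hn]
  push_cast
  rw [placeOf_add_one, placeOf_natCast B χ n (by omega)]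
  simp [nextPlace, hn]

theorem resonatorSequence_shift_one (B : BlockSystem D) (χ : ℤ → Fin D) :
    resonatorSequence B (shift 1 χ) = shift (B.len (χ 0)) (resonatorSequence B χ) := by
  let F : Place B (shift 1 χ) → Place B χ := fun x => ⟨(x.1.1 + 1, x.1.2), x.2⟩
  have hF : ∀ x, F (nextPlace B _ x) = nextPlace B _ (F x) := by
    rintro ⟨⟨j, r⟩, hr⟩
    by_cases h : r + 1 < B.len (χ (j + 1))
    · simp [F, nextPlace, h, shift]
    · simp [F, nextPlace, h, shift]
  have key : ∀ i : ℤ, F (placeOf B (shift 1 χ) i) = placeOf B χ (i + B.len (χ 0)) := by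
    intro i
    induction i using Int.induction_on with
    | zero => rw [zero_add, placeOf_len]; rfl
    | succ i ih => rw [placeOf_add_one, hF, ih, ← placeOf_add_one]; congr 1; ring
    | pred i ih =>
      have : (-i - 1 + B.len (χ 0) : ℤ) = -i + B.len (χ 0) - 1 := by ring
      rw [this, placeOf_sub_one, placeOf_sub_one, ← ih, Equiv.eq_symm_apply, ← hF,
        Equiv.apply_symm_apply]
  funext i
  have h : ∀ x : Place B χ, F (placeOf B (shift 1 χ) i) = x →
      resonatorSequence B (shift 1 χ) i = ⟨χ x.1.1, ⟨x.1.2, x.2⟩⟩ := by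
    rintro _ rfl
    rfl
  exact h _ (key i)

/-- The law of the resonator sequence is invariant under shifts. -/
theorem measurePreserving_shift_resonatorLaw (B : BlockSystem D) (p : PMF (Fin D)) :
    MeasurePreserving (shift 1) (resonatorLaw B p) (resonatorLaw B p) := by
  refine ⟨measurable_shift 1, ?_⟩
  ext S hS
  have hm : ∀ k : ℤ, Measurable fun χ => shift k (resonatorSequence B χ) := fun k =>
    (measurable_shift _).comp (measurable_resonatorSequence B)
  let g : ℤ → (ℤ → Fin D) → ℝ≥0∞ := fun k χ => S.indicator 1 (shift k (resonatorSequence B χ))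
  have hg : ∀ k, Measurable (g k) := fun k => (measurable_one.indicator hS).comp (hm k)
  have hL : ∀ S' : Set (ℤ → B.Index), MeasurableSet S' → resonatorLaw B p S' =
      (meanLength B p)⁻¹ * ∑ d, ∑ r : Fin (B.len d), ∫⁻ χ in {χ | χ 0 = d},
        S'.indicator 1 (shift ((r : ℕ) : ℤ) (resonatorSequence B χ)) ∂(blockLaw p) := by
    intro S' hS'
    simp only [resonatorLaw, Measure.smul_apply, Measure.finsetSum_apply, smul_eq_mul]
    rw [Fintype.sum_sigma]
    congr 1
    refine Finset.sum_congr rfl fun d _ => Finset.sum_congr rfl fun r _ => ?_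
    rw [← lintegral_indicator_one hS', lintegral_map (measurable_one.indicator hS') (hm _)]
  have hd : ∀ d, MeasurableSet {χ : ℤ → Fin D | χ 0 = d} := fun d =>
    (measurable_pi_apply (X := fun _ : ℤ => Fin D) 0) (measurableSet_singleton d)
  have hsplit : ∀ f : (ℤ → Fin D) → ℝ≥0∞, Measurable f →
      ∑ d, ∫⁻ χ in {χ | χ 0 = d}, f χ ∂(blockLaw p) = ∫⁻ χ, f χ ∂(blockLaw p) := by
    intro f hf
    simp_rw [← lintegral_indicator (hd _)]
    rw [← lintegral_finsetSum _ fun d _ => hf.indicator (hd d)]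
    refine lintegral_congr fun χ => ?_
    have : ∀ d, ({χ : ℤ → Fin D | χ 0 = d}.indicator f χ) = if χ 0 = d then f χ else 0 :=
      fun d => by by_cases h : χ 0 = d <;> simp [h]
    simp_rw [this, Finset.sum_ite_eq, Finset.mem_univ, if_true]
  rw [Measure.map_apply (measurable_shift 1) hS, hL _ (measurable_shift 1 hS), hL _ hS]
  congr 1
  have e1 : ∀ (r : ℕ) (χ : ℤ → Fin D), (shift 1 ⁻¹' S).indicator (1 : (ℤ → B.Index) → ℝ≥0∞)
      (shift (r : ℤ) (resonatorSequence B χ)) = g (r + 1) χ := by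
    intro r χ
    have : shift 1 (shift (r : ℤ) (resonatorSequence B χ)) =
        shift ((r : ℤ) + 1) (resonatorSequence B χ) := by
      funext i
      simp only [shift]
      congr 1
      ring
    simp only [g, ← this]
    rfl
  simp_rw [e1]
  change _ = ∑ d, ∑ r : Fin (B.len d), ∫⁻ χ in {χ | χ 0 = d}, g ((r : ℕ) : ℤ) χ ∂(blockLaw p)
  have hfin : ∫⁻ χ, g 0 χ ∂(blockLaw p) ≠ ∞ := by
    refine ne_top_of_le_ne_top (b := ∫⁻ _, 1 ∂(blockLaw p)) (by simp) (lintegral_mono fun χ => ?_)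
    exact Set.indicator_le_self' (by simp) _
  refine (ENNReal.add_left_inj hfin).1 ?_
  have hlast : ∑ d, ∫⁻ χ in {χ | χ 0 = d}, g (B.len d) χ ∂(blockLaw p) =
      ∫⁻ χ, g 0 χ ∂(blockLaw p) := by
    rw [← (measurePreserving_shift_blockLaw p 1).lintegral_comp (hg 0), ← hsplit
      (fun χ => g 0 (shift 1 χ)) ((hg 0).comp (measurable_shift 1))]
    refine Finset.sum_congr rfl fun d _ => setLIntegral_congr_fun (hd d) fun χ hχ => ?_
    have hχ' : χ 0 = d := hχ
    have : shift 0 (resonatorSequence B (shift 1 χ)) = shift (B.len d) (resonatorSequence B χ) := by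
      rw [resonatorSequence_shift_one, hχ']
      funext i
      simp [shift]
    simp only [g, this]
  conv_rhs => rw [← hlast, ← Finset.sum_add_distrib]
  rw [← hsplit _ (hg 0), ← Finset.sum_add_distrib]
  refine Finset.sum_congr rfl fun d _ => ?_
  rw [Fin.sum_univ_eq_sum_range (fun r => ∫⁻ χ in {χ | χ 0 = d}, g ((r : ℤ) + 1) χ ∂(blockLaw p)),
    Fin.sum_univ_eq_sum_range (fun r => ∫⁻ χ in {χ | χ 0 = d}, g (r : ℤ) χ ∂(blockLaw p)),
    ← Finset.sum_range_succ (fun r : ℕ => ∫⁻ χ in {χ | χ 0 = d}, g (r : ℤ) χ ∂(blockLaw p)),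
    Finset.sum_range_succ']
  simp

/-! ### Jacobi operators -/

/-- The Hilbert space `ℓ²(ℤ)`. -/
abbrev L2Z : Type := lp (fun _ : ℤ => ℂ) 2

/-- The standard basis of `ℓ²(ℤ)`. -/
noncomputable def e (i : ℤ) : L2Z := lp.single 2 i 1

theorem memℓp_weightedShift (a : lp (fun _ : ℤ => ℝ) ∞) (k : ℤ) (u : L2Z) :
    Memℓp (fun i : ℤ => (a i : ℂ) * u (i + k)) 2 := by
  have hu := (memℓp_gen_iff (p := 2) (by norm_num)).1 (lp.memℓp u)
  refine (memℓp_gen_iff (p := 2) (by norm_num)).2 ?_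
  have h2 := (((Equiv.addRight k).summable_iff).2 hu).mul_left (‖a‖ ^ 2)
  refine Summable.of_nonneg_of_le (fun i => by positivity) (fun i => ?_) h2
  have := lp.norm_apply_le_norm ENNReal.top_ne_zero a i
  simp only [norm_mul, Complex.norm_real, Function.comp, Equiv.coe_addRight,
    ENNReal.toReal_ofNat, Real.rpow_ofNat, mul_pow]
  gcongr

/-- The linear map `u ↦ (a i * u (i + k))_i` on `ℓ²(ℤ)`. -/
noncomputable def weightedShiftLinear (a : lp (fun _ : ℤ => ℝ) ∞) (k : ℤ) : L2Z →ₗ[ℂ] L2Z where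
  toFun u := ⟨fun i => (a i : ℂ) * u (i + k), memℓp_weightedShift a k u⟩
  map_add' u v := by
    ext i
    change (a i : ℂ) * (u (i + k) + v (i + k)) = a i * u (i + k) + a i * v (i + k)
    ring
  map_smul' c u := by
    ext i
    change (a i : ℂ) * (c * u (i + k)) = c * (a i * u (i + k))
    ring

theorem norm_weightedShiftLinear_le (a : lp (fun _ : ℤ => ℝ) ∞) (k : ℤ) (u : L2Z) :
    ‖weightedShiftLinear a k u‖ ≤ ‖a‖ * ‖u‖ := by
  have hu := (((Equiv.addRight k).summable_iff).2
    ((memℓp_gen_iff (p := 2) (by norm_num)).1 (lp.memℓp u))).mul_left (‖a‖ ^ 2)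
  have h1 := lp.norm_rpow_eq_tsum (p := 2) (by norm_num) u
  have h2 := lp.norm_rpow_eq_tsum (p := 2) (by norm_num) (weightedShiftLinear a k u)
  have h3 := (memℓp_gen_iff (p := 2) (by norm_num)).1 (memℓp_weightedShift a k u)
  rw [← (Equiv.addRight k).tsum_eq] at h1
  simp only [Function.comp_def, Equiv.coe_addRight, ENNReal.toReal_ofNat, Real.rpow_ofNat]
    at hu h1 h2 h3
  refine abs_le_of_sq_le_sq' ?_ (by positivity) |>.2
  rw [mul_pow, h1, h2, ← tsum_mul_left]
  refine Summable.tsum_le_tsum (fun i => ?_) h3 hu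
  have := lp.norm_apply_le_norm ENNReal.top_ne_zero a i
  change ‖(a i : ℂ) * u (i + k)‖ ^ 2 ≤ _
  rw [norm_mul, mul_pow, Complex.norm_real]
  gcongr

/-- The bounded operator `u ↦ (a i * u (i + k))_i` on `ℓ²(ℤ)`. -/
noncomputable def weightedShift (a : lp (fun _ : ℤ => ℝ) ∞) (k : ℤ) : L2Z →L[ℂ] L2Z :=
  (weightedShiftLinear a k).mkContinuous ‖a‖ (norm_weightedShiftLinear_le a k)

theorem weightedShift_apply (a : lp (fun _ : ℤ => ℝ) ∞) (k : ℤ) (u : L2Z) (i : ℤ) :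
    weightedShift a k u i = (a i : ℂ) * u (i + k) := rfl

/-- The shift of a bounded sequence by one. -/
def shiftOne (s : lp (fun _ : ℤ => ℝ) ∞) : lp (fun _ : ℤ => ℝ) ∞ :=
  ⟨fun i => s (i + 1), memℓp_infty
    ⟨‖s‖, by rintro _ ⟨i, rfl⟩; exact lp.norm_apply_le_norm ENNReal.top_ne_zero s (i + 1)⟩⟩

/-- The Jacobi operator on `ℓ²(ℤ)` with diagonal `q` and off-diagonal `-s`, see
`jacobiOperator_apply`. -/
noncomputable def jacobiOperator (q s : lp (fun _ : ℤ => ℝ) ∞) : L2Z →L[ℂ] L2Z :=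
  -weightedShift s (-1) + weightedShift q 0 - weightedShift (shiftOne s) 1

theorem jacobiOperator_apply (q s : lp (fun _ : ℤ => ℝ) ∞) (u : L2Z) (i : ℤ) :
    jacobiOperator q s u i =
      -(s i : ℂ) * u (i - 1) + (q i : ℂ) * u i - (s (i + 1) : ℂ) * u (i + 1) := by
  change -weightedShift s (-1) u i + weightedShift q 0 u i - weightedShift (shiftOne s) 1 u i = _
  simp only [weightedShift_apply, shiftOne, add_zero, neg_mul]
  rfl

theorem isSelfAdjoint_jacobiOperator (q s : lp (fun _ : ℤ => ℝ) ∞) :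
    IsSelfAdjoint (jacobiOperator q s) := by
  rw [ContinuousLinearMap.isSelfAdjoint_iff_isSymmetric]
  have hw : ∀ (a b : lp (fun _ : ℤ => ℝ) ∞) (k : ℤ), (∀ i, b i = a (i - k)) → ∀ u v : L2Z,
      ⟪weightedShift a k u, v⟫_ℂ = ⟪u, weightedShift b (-k) v⟫_ℂ := by
    intro a b k h u v
    rw [lp.inner_eq_tsum, lp.inner_eq_tsum, ← (Equiv.addRight k).tsum_eq (fun i =>
      ⟪u i, (weightedShift b (-k) v) i⟫_ℂ)]
    refine tsum_congr fun i => ?_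
    simp [weightedShift_apply, h]
    ring
  intro u v
  change ⟪jacobiOperator q s u, v⟫_ℂ = ⟪u, jacobiOperator q s v⟫_ℂ
  simp only [jacobiOperator, sub_apply, add_apply, neg_apply, inner_sub_left, inner_sub_right,
    inner_add_left, inner_add_right, inner_neg_left, inner_neg_right]
  rw [hw s (shiftOne s) (-1) (fun i => by simp [shiftOne]), hw q q 0 (by simp),
    hw (shiftOne s) s 1 (fun i => by simp [shiftOne])]
  simp only [neg_neg, neg_zero]
  ring

/-- The diagonal `q i = (v_i² / ℓ_i) (1 / s_{i-1} + 1 / s_i)` of the symmetrised capacitance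
operator of the resonator sequence `μ`. -/
noncomputable def diagEntry (B : BlockSystem D) (μ : ℤ → B.Index) (i : ℤ) : ℝ :=
  let R : ℤ → Resonator := fun k => B.res (μ k).1 (μ k).2
  (R i).speed ^ 2 / (R i).length * (1 / (R (i - 1)).spacing + 1 / (R i).spacing)

/-- The off-diagonal `s i = v_{i-1} v_i / (s_{i-1} √(ℓ_{i-1} ℓ_i))` of the symmetrised capacitance
operator of the resonator sequence `μ` (up to its sign). -/
noncomputable def offDiagEntry (B : BlockSystem D) (μ : ℤ → B.Index) (i : ℤ) : ℝ :=
  let R : ℤ → Resonator := fun k => B.res (μ k).1 (μ k).2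
  (R (i - 1)).speed * (R i).speed /
    ((R (i - 1)).spacing * Real.sqrt ((R (i - 1)).length * (R i).length))

theorem memℓp_diagEntry (B : BlockSystem D) (μ : ℤ → B.Index) : Memℓp (diagEntry B μ) ∞ := by
  refine memℓp_infty (Set.Finite.bddAbove ?_)
  let F : B.Index × B.Index → ℝ := fun x =>
    ‖(B.res x.2.1 x.2.2).speed ^ 2 / (B.res x.2.1 x.2.2).length *
      (1 / (B.res x.1.1 x.1.2).spacing + 1 / (B.res x.2.1 x.2.2).spacing)‖
  refine (Set.finite_range F).subset ?_
  rintro _ ⟨i, rfl⟩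
  exact ⟨(μ (i - 1), μ i), rfl⟩

theorem memℓp_offDiagEntry (B : BlockSystem D) (μ : ℤ → B.Index) : Memℓp (offDiagEntry B μ) ∞ := by
  refine memℓp_infty (Set.Finite.bddAbove ?_)
  let F : B.Index × B.Index → ℝ := fun x =>
    ‖(B.res x.1.1 x.1.2).speed * (B.res x.2.1 x.2.2).speed /
      ((B.res x.1.1 x.1.2).spacing *
        Real.sqrt ((B.res x.1.1 x.1.2).length * (B.res x.2.1 x.2.2).length))‖
  refine (Set.finite_range F).subset ?_
  rintro _ ⟨i, rfl⟩
  exact ⟨(μ (i - 1), μ i), rfl⟩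

/-- The Jacobi operator `J(μ)` of a resonator sequence `μ`. -/
noncomputable def J (B : BlockSystem D) (μ : ℤ → B.Index) : L2Z →L[ℂ] L2Z :=
  jacobiOperator ⟨diagEntry B μ, memℓp_diagEntry B μ⟩ ⟨offDiagEntry B μ, memℓp_offDiagEntry B μ⟩

/-! ### Truncations and eigenvalue counting measures -/

/-- The `K`-truncation `(A_{i,j})_{|i|, |j| ≤ K}` of an operator with real matrix entries
`A_{i,j} = ⟨e_i, A e_j⟩`. -/
noncomputable def truncation (A : L2Z →L[ℂ] L2Z) (K : ℕ) :
    Matrix (Finset.Icc (-(K : ℤ)) K) (Finset.Icc (-(K : ℤ)) K) ℝ :=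
  Matrix.of fun i j => (⟪e i, A (e j)⟫_ℂ).re

/-- The normalised eigenvalue counting measure `S ↦ |σ(A_K) ∩ S| / (2K + 1)` of the
`K`-truncation; its distribution function is the discrete integrated density of states. -/
noncomputable def countingMeasure (A : L2Z →L[ℂ] L2Z) (K : ℕ) : Measure ℝ :=
  ((2 * K + 1 : ℕ) : ℝ≥0∞)⁻¹ • Measure.count.restrict (spectrum ℝ (truncation A K))

/-! ### The resolution of the identity -/

section Resolution

variable {H : Type*} [NormedAddCommGroup H] [InnerProductSpace ℂ H] [CompleteSpace H]

/-- The kernel of the positive part `(A - t)⁺` of a self-adjoint operator `A`. -/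
noncomputable def spectralSubspace (A : H →L[ℂ] H) (t : ℝ) : Submodule ℂ H :=
  LinearMap.ker (cfc (fun x : ℝ => max (x - t) 0) A).toLinearMap

instance (A : H →L[ℂ] H) (t : ℝ) : CompleteSpace (spectralSubspace A t) :=
  (ContinuousLinearMap.isClosed_ker (cfc (fun x : ℝ => max (x - t) 0) A)).completeSpace_coe

/-- The resolution of the identity `E_A(t) = E_A((-∞, t])` of a bounded self-adjoint operator `A`:
the orthogonal projection onto the kernel of `(A - t)⁺`. -/
noncomputable def resolution (A : H →L[ℂ] H) (t : ℝ) : H →L[ℂ] H :=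
  (spectralSubspace A t).starProjection

theorem spectralSubspace_mono (A : H →L[ℂ] H) : Monotone (spectralSubspace A) := by
  intro s t hst u hu
  rcases hst.eq_or_lt with rfl | hst
  · exact hu
  have hf : Continuous fun x : ℝ => max (x - t) 0 / max (x - s) (t - s) :=
    (by fun_prop : Continuous fun x : ℝ => max (x - t) 0).div (by fun_prop)
      fun x => (lt_of_lt_of_le (sub_pos.2 hst) (le_max_right _ _)).ne'
  have hmul : (fun x : ℝ => max (x - t) 0) =
      fun x : ℝ => max (x - t) 0 / max (x - s) (t - s) * max (x - s) 0 := by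
    funext x
    rcases le_total x t with h | h
    · simp [h]
    · have h1 : 0 < x - s := by linarith
      rw [max_eq_left (by linarith : t - s ≤ x - s), max_eq_left h1.le, div_mul_cancel₀ _ h1.ne']
  have h := cfc_mul (fun x : ℝ => max (x - t) 0 / max (x - s) (t - s)) (fun x => max (x - s) 0) A
    hf.continuousOn (by fun_prop)
  rw [← hmul] at h
  change cfc (fun x : ℝ => max (x - s) 0) A u = 0 at hu
  change cfc (fun x : ℝ => max (x - t) 0) A u = 0
  rw [h]
  change cfc _ A (cfc (fun x : ℝ => max (x - s) 0) A u) = 0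
  rw [hu, map_zero]

theorem monotone_inner_resolution (A : H →L[ℂ] H) (u : H) :
    Monotone fun t : ℝ => (⟪u, resolution A t u⟫_ℂ).re := by
  intro s t hst
  have h := (Submodule.starProjection_le_starProjection_iff (U := spectralSubspace A s)
    (V := spectralSubspace A t)).2 (spectralSubspace_mono A hst)
  have h2 := ((ContinuousLinearMap.le_def _ _).1 h).re_inner_nonneg_right u
  simp only [sub_apply, inner_sub_right] at h2
  simpa [resolution] using h2

/-- The measure `⟨u, E_A(dλ) u⟩`, that is, the Lebesgue-Stieltjes measure of the non-decreasing
(right-continuous) function `λ ↦ ⟨u, E_A(λ) u⟩`. -/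
noncomputable def spectralMeasure (A : H →L[ℂ] H) (u : H) : Measure ℝ :=
  (monotone_inner_resolution A u).stieltjesFunction.measure

end Resolution

end BlockJacobi

/-!
The density of states is the mean `N` of the spectral measure of `J(μ)` at `e 0` under the
stationary law.

*Convergence.* All measures involved live on one compact interval, so weak convergence amounts to
convergence of moments (`tendsto_integral_of_tendsto_moments`). As a Jacobi matrix with nonvanishing
off-diagonal has simple spectrum (`injective_eigenvalues_truncation`), the `n`-th moment of the
counting measure is the normalised trace of `J_K ^ n`, and up to boundary terms of order `1 / K`
this trace is the sum over `|i| ≤ K` of `⟨e i, J ^ n (e i)⟩` (`abs_trace_truncation_pow_sub_le`).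
That matrix element is the translate by `i` of a function of finitely many resonators. Its averages
converge by a strong law of large numbers: summed over the resonators of one block it becomes a
local function of the i.i.d. block sequence (`blockSum`), whose translates along a residue class
modulo the range are independent (`strong_law_local`); the ends of the blocks are times with bounded
gaps and a linear growth rate, so averages along them control all averages
(`tendsto_div_of_tendsto_div_subseq`). The limit is the integral of the local function against the
stationary law (`integral_resonatorLaw`), i.e. the moment of `N`. The stationary law is a mixture of
laws of shifted block arrays, and shifts do not change averages, which transfers the convergence to
almost every stationary sequence.

*The spectral measure.* Continuous functions that decrease to the indicator of `{g = 0}` converge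
strongly, in the functional calculus, to the projection onto the kernel of `g(A)`
(`tendsto_cfc_starProjection`). Hence the Lebesgue-Stieltjes measure of `t ↦ ⟨u, E_A(t) u⟩`
is the Riesz-Markov-Kakutani measure of `f ↦ ⟨u, f(A) u⟩` (`spectralMeasure_spec`), its moments are
`⟨u, A ^ n u⟩`, and it gives to a point `t` the mass `⟨u, P u⟩`, with `P` the projection onto the
kernel of `A - t`.

*Continuity.* That kernel has dimension at most two, so the masses at `t` of the spectral measures
at `e 0, …, e (n - 1)` add up to at most two. By stationarity these masses have the same mean,
whence `n * N {t} ≤ 2` for every `n`, and `N {t} = 0` (`lintegral_spectralMeasure_singleton`).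
-/

namespace BlockJacobi

/-! ### Spectral measures of bounded self-adjoint operators -/

section SpectralMeasure

variable {H : Type*} [NormedAddCommGroup H] [InnerProductSpace ℂ H] [CompleteSpace H]

/-- Continuous functions that decrease to the indicator of the zero set of `g`, applied to `A`,
converge strongly to the orthogonal projection onto the kernel of `g(A)`. -/
theorem tendsto_cfc_starProjection {A : H →L[ℂ] H} (hA : IsSelfAdjoint A) {g : ℝ → ℝ}
    (hg : Continuous g) (hg0 : ∀ x, 0 ≤ g x) (V : Submodule ℂ H) [V.HasOrthogonalProjection]
    (hV : V = LinearMap.ker (cfc g A).toLinearMap) (u : H) :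
    Tendsto (fun n : ℕ => cfc (fun x => max (1 - n * g x) 0) A u) atTop
      (𝓝 (V.starProjection u)) := by
  set F : ℕ → H →L[ℂ] H := fun n => cfc (fun x => max (1 - n * g x) 0) A with hF
  have hFc : ∀ n : ℕ, Continuous fun x => max (1 - n * g x) 0 := fun n => by fun_prop
  have hF1 : ∀ n, ‖F n‖ ≤ 1 := fun n => norm_cfc_le zero_le_one fun x _ => by
    rw [Real.norm_of_nonneg (le_max_right _ _)]
    have : 0 ≤ n * g x := mul_nonneg n.cast_nonneg (hg0 x)
    exact max_le (by linarith) zero_le_one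
  -- `F n` acts as the identity on the kernel, since `1 - F n` is a multiple of `g(A)`
  have hker : ∀ n, ∀ v ∈ V, F n v = v := by
    intro n v hv
    have hv' : cfc g A v = 0 := by
      rw [hV] at hv
      exact hv
    have hh : Continuous fun x => (n : ℝ) / max 1 (n * g x) :=
      continuous_const.div (by fun_prop) fun x => (lt_of_lt_of_le one_pos (le_max_left _ _)).ne'
    have hfun : (fun x => max (1 - n * g x) 0) =
        fun x => (1 : ℝ) - (n : ℝ) / max 1 (n * g x) * g x := by
      funext x
      rcases le_total (n * g x) 1 with h | h
      · rw [max_eq_left (by linarith), max_eq_left h, div_one]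
      · rw [max_eq_right (by linarith), max_eq_right h, div_mul_eq_mul_div, div_self (by linarith),
          sub_self]
    have h1 : F n = 1 - cfc (fun x => (n : ℝ) / max 1 (n * g x)) A * cfc g A := by
      simp only [hF]
      rw [hfun, cfc_sub (fun _ => (1 : ℝ)) (fun x => (n : ℝ) / max 1 (n * g x) * g x) A
        (by fun_prop) ((hh.mul hg).continuousOn), cfc_const_one ℝ A,
        cfc_mul _ _ A hh.continuousOn hg.continuousOn]
    rw [h1]
    simp [hv']
  have hgs : IsSelfAdjoint (cfc g A) := cfc_predicate g A
  -- on the range of `g(A)`, `F n` is of order `1 / n`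
  have hran : ∀ v, ∀ n : ℕ, ‖F (n + 1) (cfc g A v)‖ ≤ 1 / ((n : ℝ) + 1) * ‖v‖ := by
    intro v n
    have h1 : F (n + 1) (cfc g A v) = (F (n + 1) * cfc g A) v := rfl
    rw [h1]
    refine ContinuousLinearMap.le_of_opNorm_le _ ?_ v
    simp only [hF]
    rw [← cfc_mul _ _ A (hFc _).continuousOn hg.continuousOn]
    refine norm_cfc_le (by positivity) fun x _ => ?_
    have hn : (0 : ℝ) < n + 1 := by positivity
    rw [Real.norm_of_nonneg (mul_nonneg (le_max_right _ _) (hg0 x)), le_div_iff₀ hn]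
    push_cast
    rcases le_total (((n : ℝ) + 1) * g x) 1 with h | h
    · rw [max_eq_left (by linarith)]
      have := mul_nonneg hn.le (hg0 x)
      nlinarith
    · rw [max_eq_right (by linarith)]
      simp
  have hperp : ∀ w ∈ Vᗮ, Tendsto (fun n => F n w) atTop (𝓝 0) := by
    intro w hw
    have hw' : w ∈ closure (Set.range fun v => cfc g A v) := by
      have := ContinuousLinearMap.orthogonal_ker (cfc g A)
      rw [(ContinuousLinearMap.isSelfAdjoint_iff'.1 hgs)] at this
      rw [hV, this] at hw
      exact hw
    rw [← tendsto_add_atTop_iff_nat 1, Metric.tendsto_atTop]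
    intro ε hε
    obtain ⟨_, ⟨v, rfl⟩, hv⟩ := Metric.mem_closure_iff.1 hw' (ε / 2) (by positivity)
    obtain ⟨N, hN⟩ := exists_nat_gt (2 * ‖v‖ / ε)
    refine ⟨N, fun n hn => ?_⟩
    rw [dist_zero_right]
    have h1 : F (n + 1) w = F (n + 1) (w - cfc g A v) + F (n + 1) (cfc g A v) := by
      rw [← map_add, sub_add_cancel]
    rw [dist_eq_norm] at hv
    change ‖w - cfc g A v‖ < ε / 2 at hv
    have h2 : ‖F (n + 1) (w - cfc g A v)‖ ≤ 1 * ‖w - cfc g A v‖ :=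
      ContinuousLinearMap.le_of_opNorm_le _ (hF1 _) _
    have h3 : 1 / ((n : ℝ) + 1) * ‖v‖ < ε / 2 := by
      have hn' : (N : ℝ) ≤ n := by exact_mod_cast hn
      have hn0 : (0 : ℝ) < n + 1 := by positivity
      rw [div_lt_iff₀ hε] at hN
      rw [one_div, inv_mul_lt_iff₀ hn0]
      nlinarith
    calc ‖F (n + 1) w‖ ≤ ‖F (n + 1) (w - cfc g A v)‖ + ‖F (n + 1) (cfc g A v)‖ := by
          rw [h1]; exact norm_add_le _ _
      _ < ε := by linarith [hran v n]
  have h := (tendsto_const_nhds (x := V.starProjection u) (f := atTop)).add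
    (hperp (u - V.starProjection u) (Submodule.sub_starProjection_mem_orthogonal u))
  rw [add_zero] at h
  refine h.congr fun n => ?_
  change _ = F n u
  have h1 := hker n (V.starProjection u) (Submodule.starProjection_apply_mem V u)
  rw [map_sub, h1, add_sub_cancel]

/-- The Riesz-Markov-Kakutani representation of the functional `f ↦ ⟨u, f(A) u⟩`. -/
theorem exists_measure_integral_eq_inner_cfc {A : H →L[ℂ] H} (hA : IsSelfAdjoint A) (u : H) :
    ∃ ν : Measure ℝ, IsFiniteMeasure ν ∧ ν (spectrum ℝ A)ᶜ = 0 ∧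
      ∀ f : ℝ → ℝ, Continuous f → ∫ x, f x ∂ν = (⟪u, cfc f A u⟫_ℂ).re := by
  let X := spectrum ℝ A
  have : CompactSpace X := isCompact_iff_compactSpace.1 (spectrum.isCompact A)
  let L : CompactlySupportedContinuousMap X ℝ →ₗ[ℝ] ℝ :=
    { toFun := fun f => (⟪u, cfcHom (R := ℝ) hA f.toContinuousMap u⟫_ℂ).re
      map_add' := fun f g => by
        have : (f + g).toContinuousMap = f.toContinuousMap + g.toContinuousMap := rfl
        rw [this, map_add, add_apply, inner_add_right, Complex.add_re]
      map_smul' := fun c f => by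
        have : (c • f).toContinuousMap = c • f.toContinuousMap := rfl
        rw [this, map_smul]
        simp [inner_smul_right_eq_smul] }
  have hL : ∀ f : CompactlySupportedContinuousMap X ℝ, 0 ≤ f → 0 ≤ L f := by
    intro f hf
    have h1 : 0 ≤ cfcHom (R := ℝ) hA f.toContinuousMap := by
      rw [cfcHom_nonneg_iff]
      exact hf
    have := ((ContinuousLinearMap.nonneg_iff_isPositive _).1 h1).re_inner_nonneg_right u
    exact this
  let Λ : CompactlySupportedContinuousMap X ℝ →ₚ[ℝ] ℝ := PositiveLinearMap.mk₀ L hL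
  let ρ := RealRMK.rieszMeasure Λ
  refine ⟨ρ.map Subtype.val, ?_, ?_, ?_⟩
  · have : IsFiniteMeasure ρ := by infer_instance
    infer_instance
  · rw [Measure.map_apply measurable_subtype_coe (spectrum.isCompact A).measurableSet.compl]
    simp [X]
  · intro f hf
    rw [integral_map measurable_subtype_coe.aemeasurable hf.aestronglyMeasurable]
    let f' : CompactlySupportedContinuousMap X ℝ :=
      ⟨⟨fun x => f x, hf.comp continuous_subtype_val⟩, HasCompactSupport.of_compactSpace _⟩
    have := RealRMK.integral_rieszMeasure Λ f'
    change ∫ x, f' x ∂ρ = _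
    rw [this]
    change (⟪u, cfcHom (R := ℝ) hA f'.toContinuousMap u⟫_ℂ).re = _
    rw [cfc_apply f A hA hf.continuousOn]
    rfl

/-- The functions `max (1 - n g) 0` decrease to the indicator of the zero set of `g`. -/
theorem tendsto_integral_measureReal_zeroSet (ν : Measure ℝ) [IsFiniteMeasure ν] {g : ℝ → ℝ}
    (hg : Continuous g) (hg0 : ∀ x, 0 ≤ g x) :
    Tendsto (fun n : ℕ => ∫ x, max (1 - n * g x) 0 ∂ν) atTop (𝓝 (ν.real {x | g x = 0})) := by
  have hm : MeasurableSet {x | g x = 0} := (isClosed_eq hg continuous_const).measurableSet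
  have h1 : Tendsto (fun n : ℕ => ∫ x, max (1 - n * g x) 0 ∂ν) atTop
      (𝓝 (∫ x, {x | g x = 0}.indicator (fun _ => (1 : ℝ)) x ∂ν)) := by
    refine tendsto_integral_of_dominated_convergence (fun _ => 1)
      (fun n => Continuous.aestronglyMeasurable (by fun_prop)) (integrable_const _)
      (fun n => Eventually.of_forall fun x => ?_) (Eventually.of_forall fun x => ?_)
    · rw [Real.norm_of_nonneg (le_max_right _ _)]
      have : 0 ≤ n * g x := mul_nonneg n.cast_nonneg (hg0 x)
      exact max_le (by linarith) zero_le_one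
    · by_cases hx : g x = 0
      · simp [hx]
      · have hx' : 0 < g x := lt_of_le_of_ne (hg0 x) (Ne.symm hx)
        rw [Set.indicator_of_notMem (by simpa using hx)]
        obtain ⟨N, hN⟩ := exists_nat_gt (1 / g x)
        refine tendsto_const_nhds.congr' ?_
        filter_upwards [eventually_ge_atTop N] with n hn
        have hn' : (N : ℝ) ≤ n := by exact_mod_cast hn
        rw [div_lt_iff₀ hx'] at hN
        rw [max_eq_right]
        nlinarith
  rw [integral_indicator hm, integral_const] at h1
  simpa only [smul_eq_mul, mul_one, measureReal_restrict_apply_univ] using h1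

/-- A finite measure that represents `f ↦ ⟨u, f(A) u⟩` gives to the zero set of `g ≥ 0` the mass
`⟨u, P u⟩`, where `P` is the projection onto the kernel of `g(A)`. -/
theorem measureReal_zeroSet_eq_inner_starProjection {A : H →L[ℂ] H} (hA : IsSelfAdjoint A) {u : H}
    {ν : Measure ℝ} [IsFiniteMeasure ν]
    (hν : ∀ f : ℝ → ℝ, Continuous f → ∫ x, f x ∂ν = (⟪u, cfc f A u⟫_ℂ).re) {g : ℝ → ℝ}
    (hg : Continuous g) (hg0 : ∀ x, 0 ≤ g x) (V : Submodule ℂ H) [V.HasOrthogonalProjection]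
    (hV : V = LinearMap.ker (cfc g A).toLinearMap) :
    ν.real {x | g x = 0} = (⟪u, V.starProjection u⟫_ℂ).re := by
  have h3 : Tendsto (fun n : ℕ => (⟪u, cfc (fun x => max (1 - n * g x) 0) A u⟫_ℂ).re) atTop
      (𝓝 (⟪u, V.starProjection u⟫_ℂ).re) :=
    (Complex.continuous_re.tendsto _).comp ((tendsto_const_nhds (x := u)).inner (𝕜 := ℂ)
      (tendsto_cfc_starProjection hA hg hg0 V hV u))
  refine tendsto_nhds_unique (tendsto_integral_measureReal_zeroSet ν hg hg0) (h3.congr fun n => ?_)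
  rw [hν _ (by fun_prop)]

/-- The Lebesgue-Stieltjes measure of the resolution of the identity represents the functional
`f ↦ ⟨u, f(A) u⟩`. -/
theorem spectralMeasure_spec {A : H →L[ℂ] H} (hA : IsSelfAdjoint A) (u : H) :
    IsFiniteMeasure (spectralMeasure A u) ∧ spectralMeasure A u (spectrum ℝ A)ᶜ = 0 ∧
      ∀ f : ℝ → ℝ, Continuous f → ∫ x, f x ∂(spectralMeasure A u) = (⟪u, cfc f A u⟫_ℂ).re := by
  obtain ⟨ν, hfin, hsupp, hν⟩ := exists_measure_integral_eq_inner_cfc hA u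
  have hIic : ∀ t : ℝ, (⟪u, resolution A t u⟫_ℂ).re = ν.real (Set.Iic t) := by
    intro t
    have h := measureReal_zeroSet_eq_inner_starProjection hA hν (g := fun x => max (x - t) 0)
      (by fun_prop) (fun x => le_max_right _ _) (spectralSubspace A t) rfl
    rw [resolution, ← h]
    congr 1
    ext x
    simp
  -- the Stieltjes function is defined by right limits, so right continuity is needed
  have hcont : ∀ t, ContinuousWithinAt (fun t => ν.real (Set.Iic t)) (Set.Ioi t) t := by
    intro t
    have h := tendsto_measure_biInter_gt (μ := ν) (s := fun r : ℝ => Set.Iic r) (a := t)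
      (fun r _ => measurableSet_Iic.nullMeasurableSet) (fun i j _ hij => Set.Iic_subset_Iic.2 hij)
      ⟨t + 1, by simp, measure_ne_top _ _⟩
    have h2 : ⋂ r > t, Set.Iic r = Set.Iic t := by
      ext x
      simp only [Set.mem_iInter, Set.mem_Iic]
      exact ⟨fun h => le_of_forall_gt_imp_ge_of_dense h, fun h r hr => h.trans (le_of_lt hr)⟩
    rw [h2] at h
    exact (ENNReal.tendsto_toReal (measure_ne_top ν _)).comp h
  have heq : spectralMeasure A u = ν := by
    have : IsLocallyFiniteMeasure (spectralMeasure A u) := by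
      unfold spectralMeasure
      infer_instance
    refine Measure.ext_of_Ioc _ _ fun a b hab => ?_
    have hst : ∀ t, (monotone_inner_resolution A u).stieltjesFunction t = ν.real (Set.Iic t) := by
      intro t
      rw [Monotone.stieltjesFunction_eq]
      have : (fun t : ℝ => (⟪u, resolution A t u⟫_ℂ).re) = fun t => ν.real (Set.Iic t) :=
        funext hIic
      rw [this]
      exact (continuousWithinAt_Ioi_iff_Ici.1 (hcont t)).rightLim_eq
    rw [spectralMeasure, StieltjesFunction.measure_Ioc, hst, hst, ← Set.Iic_sdiff_Iic,
      ← ofReal_measureReal, measureReal_sdiff (Set.Iic_subset_Iic.2 hab.le) measurableSet_Iic]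
  rw [heq]
  exact ⟨hfin, hsupp, hν⟩

theorem spectralMeasure_compl_Icc {A : H →L[ℂ] H} (hA : IsSelfAdjoint A) (u : H) {M : ℝ}
    (hM : ‖A‖ ≤ M) : spectralMeasure A u (Set.Icc (-M) M)ᶜ = 0 := by
  refine measure_mono_null (Set.compl_subset_compl.2 fun x hx => ?_) (spectralMeasure_spec hA u).2.1
  by_cases hH : Subsingleton H
  · have : Subsingleton (H →L[ℂ] H) := ContinuousLinearMap.uniqueOfLeft.instSubsingleton
    simp [spectrum.of_subsingleton] at hx
  · have : Nontrivial H := not_subsingleton_iff_nontrivial.1 hH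
    exact abs_le.1 ((spectrum.norm_le_norm_of_mem hx).trans hM)

theorem integral_pow_spectralMeasure {A : H →L[ℂ] H} (hA : IsSelfAdjoint A) (u : H) (n : ℕ) :
    ∫ x, x ^ n ∂(spectralMeasure A u) = (⟪u, (A ^ n) u⟫_ℂ).re := by
  rw [(spectralMeasure_spec hA u).2.2 _ (by fun_prop), cfc_pow_id (R := ℝ) A n]

theorem isProbabilityMeasure_spectralMeasure {A : H →L[ℂ] H} (hA : IsSelfAdjoint A) {u : H}
    (hu : ‖u‖ = 1) : IsProbabilityMeasure (spectralMeasure A u) := by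
  have := (spectralMeasure_spec hA u).1
  have h := integral_pow_spectralMeasure hA u 0
  simp only [pow_zero, integral_const, smul_eq_mul, mul_one] at h
  change _ = (⟪u, u⟫_ℂ).re at h
  rw [inner_self_eq_norm_sq_to_K, hu] at h
  refine ⟨?_⟩
  rw [← ENNReal.toReal_eq_one_iff, ← measureReal_def]
  simpa using h

/-- Along an orthonormal family, the masses that the spectral measures give to a point `t` add up
to at most the dimension of the kernel of `A - t`. -/
theorem sum_spectralMeasure_singleton_le {A : H →L[ℂ] H} (hA : IsSelfAdjoint A) (t : ℝ)
    (_ : FiniteDimensional ℂ (LinearMap.ker (A - algebraMap ℝ _ t).toLinearMap)) {ι : Type*}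
    {v : ι → H} (hv : Orthonormal ℂ v) (s : Finset ι) :
    ∑ i ∈ s, (spectralMeasure A (v i)).real {t} ≤
      Module.finrank ℂ (LinearMap.ker (A - algebraMap ℝ _ t).toLinearMap) := by
  set T : H →L[ℂ] H := A - algebraMap ℝ _ t
  set V : Submodule ℂ H := LinearMap.ker T.toLinearMap
  have hTs : IsSelfAdjoint T := hA.sub (IsSelfAdjoint.algebraMap _ (IsSelfAdjoint.all t))
  have hcfc : cfc (fun x : ℝ => (x - t) ^ 2) A = T ^ 2 := by
    rw [cfc_pow (fun x : ℝ => x - t) 2 A, cfc_sub (fun x : ℝ => x) (fun _ => t) A, cfc_id' ℝ A,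
      cfc_const t A]
  have hVk : V = LinearMap.ker (cfc (fun x : ℝ => (x - t) ^ 2) A).toLinearMap := by
    rw [hcfc]
    ext u
    change T u = 0 ↔ T (T u) = 0
    refine ⟨fun h => by rw [h, map_zero], fun h => ?_⟩
    have h1 : ⟪T u, T u⟫_ℂ = ⟪T (T u), u⟫_ℂ :=
      ((ContinuousLinearMap.isSelfAdjoint_iff_isSymmetric.1 hTs) (T u) u).symm
    rw [h, inner_zero_left] at h1
    exact inner_self_eq_zero.1 h1
  let b := stdOrthonormalBasis ℂ V
  have hmass : ∀ u, (spectralMeasure A u).real {t} = ∑ j, ‖⟪u, (b j : H)⟫_ℂ‖ ^ 2 := by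
    intro u
    obtain ⟨h1, -, h2⟩ := spectralMeasure_spec hA u
    have h3 := measureReal_zeroSet_eq_inner_starProjection hA h2
      (g := fun x => (x - t) ^ 2) (by fun_prop) (fun x => sq_nonneg _) V hVk
    have h4 : {x : ℝ | (x - t) ^ 2 = 0} = {t} := by
      ext x
      simp [sub_eq_zero]
    rw [h4] at h3
    rw [h3, Submodule.starProjection_apply, b.orthogonalProjectionOnto_apply_eq_sum,
      Submodule.coe_sum, inner_sum, Complex.re_sum]
    refine Finset.sum_congr rfl fun j _ => ?_
    rw [Submodule.coe_smul, inner_smul_right, ← inner_conj_symm, ← Complex.normSq_eq_conj_mul_self,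
      Complex.ofReal_re, Complex.normSq_eq_norm_sq]
  simp_rw [hmass]
  rw [Finset.sum_comm]
  have hb : ∀ j, ∑ i ∈ s, ‖⟪v i, (b j : H)⟫_ℂ‖ ^ 2 ≤ 1 := fun j => by
    have h1 := hv.sum_inner_products_le (b j : H) (s := s)
    have h2 : ‖(b j : H)‖ = 1 := b.orthonormal.1 j
    simpa [h2] using h1
  calc _ ≤ ∑ j : Fin (Module.finrank ℂ V), (1 : ℝ) := Finset.sum_le_sum fun j _ => hb j
    _ = _ := by simp

end SpectralMeasure

/-! ### Moments and weak convergence -/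

theorem integrable_of_compl_Icc {ν : Measure ℝ} [IsFiniteMeasure ν] {M : ℝ}
    (hν : ν (Set.Icc (-M) M)ᶜ = 0) {f : ℝ → ℝ} (hf : Continuous f) : Integrable f ν := by
  have h := hf.continuousOn.integrableOn_compact (μ := ν) (isCompact_Icc (a := -M) (b := M))
  rwa [IntegrableOn, Measure.restrict_eq_self_of_ae_mem] at h
  exact mem_ae_iff.2 hν

theorem abs_integral_sub_le_of_compl_Icc {τ : Measure ℝ} [IsProbabilityMeasure τ] {M : ℝ}
    (hτ : τ (Set.Icc (-M) M)ᶜ = 0) {f g : ℝ → ℝ} (hf : Continuous f) (hg : Continuous g) {ε : ℝ}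
    (h : ∀ x ∈ Set.Icc (-M) M, |f x - g x| ≤ ε) : |∫ x, f x ∂τ - ∫ x, g x ∂τ| ≤ ε := by
  rw [← integral_sub (integrable_of_compl_Icc hτ hf) (integrable_of_compl_Icc hτ hg)]
  have h1 := norm_integral_le_of_norm_le_const (μ := τ) (f := fun x => f x - g x) (C := ε) ?_
  · simpa using h1
  · have : ∀ᵐ x ∂τ, x ∈ Set.Icc (-M) M := mem_ae_iff.2 hτ
    filter_upwards [this] with x hx
    exact h x hx

/-- Convergence of moments implies weak convergence, for probability measures that are all
supported in one compact interval. -/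
theorem tendsto_integral_of_tendsto_moments {M : ℝ} {ν : ℕ → Measure ℝ} {ρ : Measure ℝ}
    [∀ n, IsProbabilityMeasure (ν n)] [IsProbabilityMeasure ρ]
    (hν : ∀ n, ν n (Set.Icc (-M) M)ᶜ = 0) (hρ : ρ (Set.Icc (-M) M)ᶜ = 0)
    (h : ∀ k : ℕ, Tendsto (fun n => ∫ x, x ^ k ∂(ν n)) atTop (𝓝 (∫ x, x ^ k ∂ρ))) {f : ℝ → ℝ}
    (hf : Continuous f) :
    Tendsto (fun n => ∫ x, f x ∂(ν n)) atTop (𝓝 (∫ x, f x ∂ρ)) := by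
  have hpoly : ∀ p : Polynomial ℝ, Tendsto (fun n => ∫ x, p.eval x ∂(ν n)) atTop
      (𝓝 (∫ x, p.eval x ∂ρ)) := by
    intro p
    induction p using Polynomial.induction_on' with
    | add p q hp hq =>
      simp only [Polynomial.eval_add]
      rw [integral_add (integrable_of_compl_Icc hρ p.continuous)
        (integrable_of_compl_Icc hρ q.continuous)]
      refine (hp.add hq).congr fun n => ?_
      rw [integral_add (integrable_of_compl_Icc (hν n) p.continuous)
        (integrable_of_compl_Icc (hν n) q.continuous)]
    | monomial k a =>
      simp only [Polynomial.eval_monomial, integral_const_mul]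
      exact (h k).const_mul a
  rw [Metric.tendsto_atTop]
  intro ε hε
  obtain ⟨p, hp⟩ := exists_polynomial_near_of_continuousOn (-M) M f hf.continuousOn (ε / 3)
    (by positivity)
  have hclose : ∀ (τ : Measure ℝ) [IsProbabilityMeasure τ], τ (Set.Icc (-M) M)ᶜ = 0 →
      |∫ x, p.eval x ∂τ - ∫ x, f x ∂τ| ≤ ε / 3 := fun τ _ hτ =>
    abs_integral_sub_le_of_compl_Icc hτ p.continuous hf fun x hx => (hp x hx).le
  obtain ⟨n₀, hn₀⟩ := Metric.tendsto_atTop.1 (hpoly p) (ε / 3) (by positivity)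
  refine ⟨n₀, fun n hn => ?_⟩
  have h1 := abs_lt.1 (hn₀ n hn)
  have h2 := abs_le.1 (hclose (ν n) (hν n))
  have h3 := abs_le.1 (hclose ρ hρ)
  rw [Real.dist_eq, abs_lt]
  constructor <;> linarith

/-- Compactly supported probability measures are determined by their moments. -/
theorem ext_of_moments {M : ℝ} {ρ₁ ρ₂ : Measure ℝ} [IsProbabilityMeasure ρ₁]
    [IsProbabilityMeasure ρ₂] (h₁ : ρ₁ (Set.Icc (-M) M)ᶜ = 0) (h₂ : ρ₂ (Set.Icc (-M) M)ᶜ = 0)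
    (h : ∀ k : ℕ, ∫ x, x ^ k ∂ρ₁ = ∫ x, x ^ k ∂ρ₂) : ρ₁ = ρ₂ := by
  refine ext_of_forall_integral_eq_of_IsFiniteMeasure fun f => ?_
  have := tendsto_integral_of_tendsto_moments (ν := fun _ => ρ₁) (fun _ => h₁) h₂
    (fun k => by rw [h k]; exact tendsto_const_nhds) f.continuous
  exact tendsto_nhds_unique tendsto_const_nhds this

/-! ### Matrix elements of powers of a Jacobi operator -/

/-- The `j`-th column of the `n`-th power of the (formal) Jacobi matrix with diagonal `q` and
off-diagonal `-s`. -/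
def jacobiPow (q s : ℤ → ℝ) (j : ℤ) : ℕ → ℤ → ℝ
  | 0, i => if i = j then 1 else 0
  | n + 1, i => -s i * jacobiPow q s j n (i - 1) + q i * jacobiPow q s j n i -
      s (i + 1) * jacobiPow q s j n (i + 1)

theorem e_apply (i j : ℤ) : e j i = if i = j then 1 else 0 := by
  simp [e, Pi.single_apply]

theorem orthonormal_e : Orthonormal ℂ e := by
  rw [orthonormal_iff_ite]
  intro i j
  rw [e, lp.inner_single_left, e_apply]
  simp

theorem inner_e_left (i : ℤ) (u : L2Z) : ⟪e i, u⟫_ℂ = u i := by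
  rw [e, lp.inner_single_left]
  simp

theorem jacobiOperator_pow_apply_e (q s : lp (fun _ : ℤ => ℝ) ∞) (j : ℤ) (n : ℕ) (i : ℤ) :
    (jacobiOperator q s ^ n) (e j) i = (jacobiPow q s j n i : ℂ) := by
  induction n generalizing i with
  | zero =>
    change e j i = _
    rw [e_apply, jacobiPow]
    split_ifs <;> simp
  | succ n ih =>
    have : (jacobiOperator q s ^ (n + 1)) (e j) =
        jacobiOperator q s ((jacobiOperator q s ^ n) (e j)) := by
      rw [pow_succ']; rfl
    rw [this, jacobiOperator_apply, ih, ih, ih, jacobiPow]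
    push_cast
    ring

theorem abs_jacobiPow_le {q s : ℤ → ℝ} {C : ℝ} (hq : ∀ i, |q i| ≤ C) (hs : ∀ i, |s i| ≤ C)
    (j : ℤ) (n : ℕ) (i : ℤ) : |jacobiPow q s j n i| ≤ (3 * C) ^ n := by
  have hC : 0 ≤ C := (abs_nonneg _).trans (hq 0)
  induction n generalizing i with
  | zero => rw [jacobiPow]; split_ifs <;> simp
  | succ n ih =>
    have h : ∀ a b : ℝ, |a| ≤ C → |b| ≤ (3 * C) ^ n → |a * b| ≤ C * (3 * C) ^ n := by
      intro a b ha hb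
      rw [abs_mul]
      gcongr
    have h1 := abs_le.1 (h _ _ (hs i) (ih (i - 1)))
    have h2 := abs_le.1 (h _ _ (hq i) (ih i))
    have h3 := abs_le.1 (h _ _ (hs (i + 1)) (ih (i + 1)))
    rw [jacobiPow, pow_succ, abs_le]
    constructor <;> linarith

/-- The matrix element in row `i` of the `n`-th power only involves the entries with numbers
between `i - n` and `i + n + 1`. -/
theorem jacobiPow_congr {q s q' s' : ℤ → ℝ} (j : ℤ) (n : ℕ) (i : ℤ)
    (hq : ∀ k, i - n ≤ k → k ≤ i + n + 1 → q k = q' k)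
    (hs : ∀ k, i - n ≤ k → k ≤ i + n + 1 → s k = s' k) :
    jacobiPow q s j n i = jacobiPow q' s' j n i := by
  induction n generalizing i with
  | zero => rfl
  | succ n ih =>
    push_cast at hq hs
    have h : ∀ l, i - 1 ≤ l → l ≤ i + 1 → jacobiPow q s j n l = jacobiPow q' s' j n l :=
      fun l h1 h2 => ih l (fun k _ _ => hq k (by linarith) (by linarith))
        (fun k _ _ => hs k (by linarith) (by linarith))
    rw [jacobiPow, jacobiPow, h (i - 1) (by linarith) (by linarith),
      h i (by linarith) (by linarith), h (i + 1) (by linarith) (by linarith),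
      hq i (by linarith) (by linarith),
      hs i (by linarith) (by linarith), hs (i + 1) (by linarith) (by linarith)]

theorem jacobiPow_translate (q s : ℤ → ℝ) (j k : ℤ) (n : ℕ) (i : ℤ) :
    jacobiPow q s (j + k) n (i + k) =
      jacobiPow (fun l => q (l + k)) (fun l => s (l + k)) j n i := by
  induction n generalizing i with
  | zero => simp [jacobiPow]
  | succ n ih =>
    have h1 : i + k - 1 = i - 1 + k := by ring
    have h2 : i + k + 1 = i + 1 + k := by ring
    rw [jacobiPow, jacobiPow, h1, h2, ih, ih, ih]

theorem norm_jacobiOperator_le {q s : lp (fun _ : ℤ => ℝ) ∞} {C : ℝ} (hq : ∀ i, |q i| ≤ C)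
    (hs : ∀ i, |s i| ≤ C) : ‖jacobiOperator q s‖ ≤ 3 * C := by
  have hC : 0 ≤ C := (abs_nonneg _).trans (hq 0)
  have h : ∀ (a : lp (fun _ : ℤ => ℝ) ∞) (k : ℤ), (∀ i, |a i| ≤ C) → ‖weightedShift a k‖ ≤ C :=
    fun a k ha => (LinearMap.mkContinuous_norm_le _ (norm_nonneg a) _).trans
      (lp.norm_le_of_forall_le hC ha)
  have h1 := h s (-1) hs
  have h2 := h q 0 hq
  have h3 := h (shiftOne s) 1 fun i => hs (i + 1)
  calc ‖jacobiOperator q s‖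
      ≤ ‖-weightedShift s (-1)‖ + ‖weightedShift q 0‖ + ‖weightedShift (shiftOne s) 1‖ :=
        (norm_sub_le _ _).trans (add_le_add_left (norm_add_le _ _) _)
    _ ≤ 3 * C := by rw [norm_neg]; linarith

/-- A formal eigenfunction of a Jacobi operator with nonvanishing off-diagonal is determined by two
of its values. -/
theorem finiteDimensional_ker_jacobiOperator_sub {q s : lp (fun _ : ℤ => ℝ) ∞} (hs : ∀ i, s i ≠ 0)
    (t : ℝ) :
    FiniteDimensional ℂ (LinearMap.ker (jacobiOperator q s - algebraMap ℝ _ t).toLinearMap) ∧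
      Module.finrank ℂ (LinearMap.ker (jacobiOperator q s - algebraMap ℝ _ t).toLinearMap) ≤ 2 := by
  let V := LinearMap.ker (jacobiOperator q s - algebraMap ℝ (L2Z →L[ℂ] L2Z) t).toLinearMap
  let F : V →ₗ[ℂ] (Fin 2 → ℂ) :=
    { toFun := fun u => ![(u : L2Z) 0, (u : L2Z) 1]
      map_add' := fun u v => by ext i; fin_cases i <;> rfl
      map_smul' := fun c u => by ext i; fin_cases i <;> rfl }
  have hF : Function.Injective F := by
    rw [← LinearMap.ker_eq_bot, LinearMap.ker_eq_bot']
    rintro ⟨u, hu⟩ h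
    have h0 : u 0 = 0 := congrFun h 0
    have h1 : u 1 = 0 := congrFun h 1
    have hrec : ∀ i, -(s i : ℂ) * u (i - 1) + (q i : ℂ) * u i - (s (i + 1) : ℂ) * u (i + 1) =
        t * u i := by
      intro i
      have hu' : jacobiOperator q s u = (algebraMap ℝ (L2Z →L[ℂ] L2Z) t) u := sub_eq_zero.1 hu
      rw [← jacobiOperator_apply, hu', Algebra.algebraMap_eq_smul_one]
      change t • u i = _
      rw [Complex.real_smul]
    have hs' : ∀ i, (s i : ℂ) ≠ 0 := fun i => Complex.ofReal_ne_zero.2 (hs i)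
    have key : ∀ i : ℤ, u i = 0 ∧ u (i + 1) = 0 := by
      intro i
      induction i using Int.induction_on with
      | zero => exact ⟨h0, h1⟩
      | succ i ih =>
        refine ⟨ih.2, ?_⟩
        have := hrec (i + 1)
        rw [add_sub_cancel_right, ih.1, ih.2] at this
        simpa [hs'] using this
      | pred i ih =>
        rw [sub_add_cancel]
        refine ⟨?_, ih.1⟩
        have := hrec (-i)
        rw [ih.1, ih.2] at this
        simpa [hs'] using this
    ext i
    exact (key i).1
  have : FiniteDimensional ℂ V := Module.Finite.of_injective F hF
  refine ⟨this, ?_⟩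
  exact (LinearMap.finrank_le_finrank_of_injective hF).trans (by simp)

/-! ### Truncated Jacobi matrices -/

section Truncation

variable (q s : lp (fun _ : ℤ => ℝ) ∞) (K : ℕ)

theorem truncation_jacobiOperator_apply (i j : Finset.Icc (-(K : ℤ)) K) :
    truncation (jacobiOperator q s) K i j =
      -s i * (if (i : ℤ) - 1 = j then 1 else 0) + q i * (if (i : ℤ) = j then 1 else 0) -
        s (i + 1) * (if (i : ℤ) + 1 = j then 1 else 0) := by
  have h := jacobiOperator_pow_apply_e q s j 1 i
  rw [pow_one] at h
  rw [truncation, Matrix.of_apply, inner_e_left, h, Complex.ofReal_re]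
  rfl

theorem isHermitian_truncation : (truncation (jacobiOperator q s) K).IsHermitian := by
  have h := ContinuousLinearMap.isSelfAdjoint_iff_isSymmetric.1 (isSelfAdjoint_jacobiOperator q s)
  ext i j
  rw [Matrix.conjTranspose_apply, star_trivial, truncation, Matrix.of_apply, Matrix.of_apply,
    ← inner_conj_symm, Complex.conj_re]
  exact congrArg Complex.re (h (e i) (e j))

/-- The extension by zero to `ℤ` of a vector on `[-K, K]`. -/
noncomputable def extendZero {K : ℕ} (v : Finset.Icc (-(K : ℤ)) K → ℝ) (i : ℤ) : ℝ :=
  if h : i ∈ Finset.Icc (-(K : ℤ)) K then v ⟨i, h⟩ else 0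

theorem extendZero_coe {K : ℕ} (v : Finset.Icc (-(K : ℤ)) K → ℝ) (i : Finset.Icc (-(K : ℤ)) K) :
    extendZero v i = v i := by
  simp [extendZero]

theorem truncation_mulVec (v : Finset.Icc (-(K : ℤ)) K → ℝ) (i : Finset.Icc (-(K : ℤ)) K) :
    (truncation (jacobiOperator q s) K).mulVec v i =
      -s i * extendZero v (i - 1) + q i * extendZero v i - s (i + 1) * extendZero v (i + 1) := by
  have h : ∀ k : ℤ, ∑ j : Finset.Icc (-(K : ℤ)) K, (if k = (j : ℤ) then (1 : ℝ) else 0) * v j =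
      extendZero v k := by
    intro k
    simp_rw [← extendZero_coe v]
    rw [Finset.sum_coe_sort (Finset.Icc (-(K : ℤ)) K)
      (fun j => (if k = j then (1 : ℝ) else 0) * extendZero v j)]
    simp only [ite_mul, one_mul, zero_mul, Finset.sum_ite_eq]
    by_cases hk : k ∈ Finset.Icc (-(K : ℤ)) K
    · rw [if_pos hk]
    · rw [if_neg hk, extendZero, dif_neg hk]
  simp only [Matrix.mulVec, dotProduct, truncation_jacobiOperator_apply, add_mul, sub_mul,
    mul_assoc, Finset.sum_add_distrib, Finset.sum_sub_distrib, ← Finset.mul_sum, h]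

/-- The powers of the truncated matrix are those of the Jacobi matrix whose off-diagonal is set to
zero at the bonds that leave `[-K, K]`. -/
theorem truncation_pow_apply (n : ℕ) (i j : Finset.Icc (-(K : ℤ)) K) :
    (truncation (jacobiOperator q s) K ^ n) i j =
      jacobiPow q (fun k => if -(K : ℤ) < k ∧ k ≤ K then s k else 0) j n i := by
  induction n generalizing i with
  | zero =>
    rw [pow_zero, Matrix.one_apply, jacobiPow]
    simp only [Subtype.ext_iff]
  | succ n ih =>
    have h : (truncation (jacobiOperator q s) K ^ (n + 1)) i j =
        (truncation (jacobiOperator q s) K).mulVec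
          (fun l => (truncation (jacobiOperator q s) K ^ n) l j) i := by
      rw [pow_succ', Matrix.mul_apply]; rfl
    have hi := Finset.mem_Icc.1 i.2
    rw [h, truncation_mulVec, jacobiPow]
    have hext : ∀ l : ℤ, l ∈ Finset.Icc (-(K : ℤ)) K →
        extendZero (fun l => (truncation (jacobiOperator q s) K ^ n) l j) l =
          jacobiPow q (fun k => if -(K : ℤ) < k ∧ k ≤ K then s k else 0) j n l := by
      intro l hl
      rw [extendZero, dif_pos hl, ih]
    have hext' : ∀ l : ℤ, l ∉ Finset.Icc (-(K : ℤ)) K →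
        extendZero (fun l => (truncation (jacobiOperator q s) K ^ n) l j) l = 0 := by
      intro l hl
      rw [extendZero, dif_neg hl]
    rw [hext i i.2]
    congr 1
    · congr 1
      by_cases h1 : (i : ℤ) - 1 ∈ Finset.Icc (-(K : ℤ)) K
      · have h2 := Finset.mem_Icc.1 h1
        rw [hext _ h1, if_pos ⟨by linarith, hi.2⟩]
      · rw [hext' _ h1, if_neg, neg_zero, mul_zero, zero_mul]
        rintro ⟨h2, h3⟩
        exact h1 (Finset.mem_Icc.2 ⟨by omega, by omega⟩)
    · by_cases h1 : (i : ℤ) + 1 ∈ Finset.Icc (-(K : ℤ)) K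
      · have h2 := Finset.mem_Icc.1 h1
        rw [hext _ h1, if_pos ⟨by linarith, h2.2⟩]
      · rw [hext' _ h1, if_neg, mul_zero, zero_mul]
        rintro ⟨h2, h3⟩
        exact h1 (Finset.mem_Icc.2 ⟨by omega, by omega⟩)

variable {q s K}

/-- An eigenvector of the truncated matrix is determined by its first entry. -/
theorem eq_zero_of_truncation_mulVec_eq (hs : ∀ i, s i ≠ 0) {v : Finset.Icc (-(K : ℤ)) K → ℝ}
    {t : ℝ} (hv : (truncation (jacobiOperator q s) K).mulVec v = t • v)
    (h0 : extendZero v (-K) = 0) : v = 0 := by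
  have key : ∀ m : ℕ, m ≤ 2 * K →
      extendZero v (-K + m - 1) = 0 ∧ extendZero v (-K + m) = 0 := by
    intro m
    induction m with
    | zero =>
      intro _
      refine ⟨?_, by simpa using h0⟩
      rw [extendZero, dif_neg]
      simp
    | succ m ih =>
      intro hm
      obtain ⟨h1, h2⟩ := ih (by omega)
      push_cast
      have e1 : (-K + (m + 1) - 1 : ℤ) = -K + m := by ring
      have e2 : (-K + (m + 1) : ℤ) = -K + m + 1 := by ring
      rw [e1, e2]
      refine ⟨h2, ?_⟩
      have hmem : (-K + m : ℤ) ∈ Finset.Icc (-(K : ℤ)) K := Finset.mem_Icc.2 ⟨by omega, by omega⟩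
      have h3 := congrFun hv ⟨_, hmem⟩
      rw [truncation_mulVec, Pi.smul_apply, ← extendZero_coe v] at h3
      simp only [h1, h2, mul_zero, smul_zero, zero_add, zero_sub, neg_eq_zero, mul_eq_zero,
        hs, false_or] at h3
      exact h3
  funext i
  have hi := Finset.mem_Icc.1 i.2
  have h := (key ((i : ℤ) + K).toNat (by omega)).2
  have e1 : (-K + (((i : ℤ) + K).toNat : ℤ) : ℤ) = i := by omega
  rw [e1, extendZero_coe] at h
  exact h

/-- Compare the two sides of the eigenvalue equation at the largest entry of the eigenvector. -/
theorem abs_le_of_truncation_mulVec_eq {C : ℝ} (hqC : ∀ i, |q i| ≤ C) (hsC : ∀ i, |s i| ≤ C)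
    {v : Finset.Icc (-(K : ℤ)) K → ℝ} (hv0 : v ≠ 0)
    {t : ℝ} (hv : (truncation (jacobiOperator q s) K).mulVec v = t • v) : |t| ≤ 3 * C := by
  have hC : 0 ≤ C := (abs_nonneg _).trans (hqC 0)
  have : Nonempty (Finset.Icc (-(K : ℤ)) K) := ⟨⟨0, by simp⟩⟩
  obtain ⟨i, hi⟩ := Finite.exists_max fun i => |v i|
  have hpos : 0 < |v i| := by
    by_contra h
    exact hv0 (funext fun j => abs_nonpos_iff.1 ((hi j).trans (not_lt.1 h)))
  have hext : ∀ l, |extendZero v l| ≤ |v i| := by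
    intro l
    rw [extendZero]
    split_ifs with h
    · exact hi _
    · simp
  have h := congrFun hv i
  rw [truncation_mulVec, Pi.smul_apply, smul_eq_mul] at h
  have hb : ∀ a b : ℝ, |a| ≤ C → |b| ≤ |v i| → |a * b| ≤ C * |v i| := fun a b ha hb => by
    rw [abs_mul]; gcongr
  have h1 := abs_le.1 (hb _ _ (hsC i) (hext (i - 1)))
  have h2 := abs_le.1 (hb _ _ (hqC i) (hext i))
  have h3 := abs_le.1 (hb _ _ (hsC (i + 1)) (hext (i + 1)))
  have h4 : |t| * |v i| ≤ 3 * C * |v i| := by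
    rw [← abs_mul, ← h, abs_le]
    constructor <;> linarith
  exact le_of_mul_le_mul_right h4 hpos

/-- The truncated matrix has simple spectrum: of two orthogonal eigenvectors for one eigenvalue,
some nontrivial combination has vanishing first entry, which forces it to vanish. -/
theorem injective_eigenvalues_truncation (hs : ∀ i, s i ≠ 0) :
    Function.Injective (isHermitian_truncation q s K).eigenvalues := by
  set hT := isHermitian_truncation q s K
  intro a b hab
  by_contra hne
  let va : Finset.Icc (-(K : ℤ)) K → ℝ := ⇑(hT.eigenvectorBasis a)
  let vb : Finset.Icc (-(K : ℤ)) K → ℝ := ⇑(hT.eigenvectorBasis b)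
  have ha : (truncation (jacobiOperator q s) K).mulVec va = hT.eigenvalues a • va :=
    hT.mulVec_eigenvectorBasis a
  have hb : (truncation (jacobiOperator q s) K).mulVec vb = hT.eigenvalues b • vb :=
    hT.mulVec_eigenvectorBasis b
  have hext : ∀ (x y : ℝ) (l : ℤ), extendZero (x • va + y • vb) l =
      x * extendZero va l + y * extendZero vb l := by
    intro x y l
    simp only [extendZero]
    split_ifs <;> simp
  -- a combination of the two eigenvectors whose first entry vanishes
  have h := eq_zero_of_truncation_mulVec_eq (t := hT.eigenvalues a) hs
    (v := extendZero vb (-K) • va + (-extendZero va (-K)) • vb)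
    (by rw [Matrix.mulVec_add, Matrix.mulVec_smul, Matrix.mulVec_smul, ha, hb, ← hab, smul_add,
      smul_comm, smul_comm (hT.eigenvalues a) (-extendZero va (-K))]) (by rw [hext]; ring)
  have hw : extendZero vb (-K) • hT.eigenvectorBasis a +
      (-extendZero va (-K)) • hT.eigenvectorBasis b = 0 := by
    ext i
    exact congrFun h i
  have hin := congrArg (fun w => ⟪hT.eigenvectorBasis a, w⟫_ℝ) hw
  have horth := orthonormal_iff_ite.1 hT.eigenvectorBasis.orthonormal
  simp only [inner_add_right, inner_smul_right, horth, hne, if_true, if_false, inner_zero_right,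
    mul_one, mul_zero, add_zero] at hin
  refine hT.eigenvectorBasis.orthonormal.ne_zero b ?_
  ext i
  exact congrFun (eq_zero_of_truncation_mulVec_eq hs hb hin) i

/-- As the spectrum is simple, counting it as a set is the same as counting eigenvalues with
multiplicity. -/
theorem integral_countingMeasure (hs : ∀ i, s i ≠ 0) (f : ℝ → ℝ) :
    ∫ x, f x ∂(countingMeasure (jacobiOperator q s) K) =
      ((2 * K + 1 : ℕ) : ℝ)⁻¹ * ∑ k, f ((isHermitian_truncation q s K).eigenvalues k) := by
  set hT := isHermitian_truncation q s K
  have hspec : spectrum ℝ (truncation (jacobiOperator q s) K) =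
      ((Finset.univ.image hT.eigenvalues : Finset ℝ) : Set ℝ) := by
    rw [hT.spectrum_real_eq_range_eigenvalues]
    simp
  rw [countingMeasure, integral_smul_measure, hspec, setIntegral_finset]
  · rw [Finset.sum_image fun a _ b _ h => injective_eigenvalues_truncation hs h]
    rw [ENNReal.toReal_inv, ENNReal.toReal_natCast]
    simp [measureReal_def]
  · rw [← Set.biUnion_of_singleton ((Finset.univ.image hT.eigenvalues : Finset ℝ) : Set ℝ),
      integrableOn_finite_biUnion (Finset.finite_toSet _)]
    exact fun x _ => integrableOn_singleton (by finiteness) (by simp)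

theorem isProbabilityMeasure_countingMeasure (hs : ∀ i, s i ≠ 0) :
    IsProbabilityMeasure (countingMeasure (jacobiOperator q s) K) := by
  have h := integral_countingMeasure (K := K) (q := q) hs fun _ => 1
  refine ⟨?_⟩
  rw [← ENNReal.toReal_eq_one_iff, ← measureReal_def]
  have h2 : (((2 * K + 1 : ℕ) : ℝ)) ≠ 0 := by positivity
  have h3 : (K + 1 - -K : ℤ).toNat = 2 * K + 1 := by omega
  rw [integral_const, smul_eq_mul, mul_one, Finset.sum_const, Finset.card_univ, Fintype.card_coe,
    Int.card_Icc, h3, nsmul_one, inv_mul_cancel₀ h2] at h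
  exact h

theorem countingMeasure_compl_Icc {C : ℝ} (hqC : ∀ i, |q i| ≤ C) (hsC : ∀ i, |s i| ≤ C) :
    countingMeasure (jacobiOperator q s) K (Set.Icc (-(3 * C)) (3 * C))ᶜ = 0 := by
  set hT := isHermitian_truncation q s K
  rw [countingMeasure, Measure.smul_apply, Measure.restrict_apply measurableSet_Icc.compl]
  have : (Set.Icc (-(3 * C)) (3 * C))ᶜ ∩ spectrum ℝ (truncation (jacobiOperator q s) K) = ∅ := by
    rw [hT.spectrum_real_eq_range_eigenvalues, ← Set.disjoint_iff_inter_eq_empty,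
      Set.disjoint_compl_left_iff_subset]
    rintro _ ⟨k, rfl⟩
    refine abs_le.1 (abs_le_of_truncation_mulVec_eq hqC hsC ?_ (hT.mulVec_eigenvectorBasis k))
    intro h
    refine hT.eigenvectorBasis.orthonormal.ne_zero k ?_
    ext i
    exact congrFun h i
  rw [this]
  simp

theorem integral_pow_countingMeasure (hs : ∀ i, s i ≠ 0) (n : ℕ) :
    ∫ x, x ^ n ∂(countingMeasure (jacobiOperator q s) K) =
      ((2 * K + 1 : ℕ) : ℝ)⁻¹ * Matrix.trace (truncation (jacobiOperator q s) K ^ n) := by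
  rw [integral_countingMeasure hs]
  congr 1
  set hT := isHermitian_truncation q s K
  conv_rhs => rw [hT.spectral_theorem, ← map_pow, Matrix.diagonal_pow]
  rw [Unitary.conjStarAlgAut_apply, Matrix.trace_mul_cycle]
  simp [Matrix.trace]

/-- The truncation only changes the diagonal entries of the `n`-th power at distance at most `n`
from the ends of `[-K, K]`, of which there are at most `2 (n + 1)`. -/
theorem abs_trace_truncation_pow_sub_le {C : ℝ} (hqC : ∀ i, |q i| ≤ C) (hsC : ∀ i, |s i| ≤ C)
    (n : ℕ) :
    |Matrix.trace (truncation (jacobiOperator q s) K ^ n) -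
      ∑ i ∈ Finset.Icc (-(K : ℤ)) K, jacobiPow q s i n i| ≤ 4 * (n + 1) * (3 * C) ^ n := by
  have hC : 0 ≤ C := (abs_nonneg _).trans (hqC 0)
  set s' : ℤ → ℝ := fun k => if -(K : ℤ) < k ∧ k ≤ K then s k else 0 with hs'
  have htr : Matrix.trace (truncation (jacobiOperator q s) K ^ n) =
      ∑ i ∈ Finset.Icc (-(K : ℤ)) K, jacobiPow q s' i n i := by
    rw [Matrix.trace, ← Finset.sum_coe_sort (Finset.Icc (-(K : ℤ)) K)]
    exact Finset.sum_congr rfl fun i _ => truncation_pow_apply q s K n i i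
  have hsC' : ∀ i, |s' i| ≤ C := by
    intro i
    simp only [hs']
    split_ifs
    · exact hsC i
    · simpa using hC
  set S : Finset ℤ := Finset.Icc (-K : ℤ) (-K + n) ∪ Finset.Icc (K - n : ℤ) K with hS
  rw [htr, ← Finset.sum_sub_distrib]
  have hzero : ∀ i ∈ Finset.Icc (-(K : ℤ)) K, i ∉ S →
      jacobiPow q s' i n i - jacobiPow q s i n i = 0 := by
    intro i hi hiS
    rw [Finset.mem_Icc] at hi
    simp only [hS, Finset.mem_union, Finset.mem_Icc, not_or, not_and, not_le] at hiS
    have h1 := hiS.1 hi.1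
    have h2 : i < K - n := by
      by_contra h
      exact absurd (hiS.2 (not_lt.1 h)) (not_lt.2 hi.2)
    rw [sub_eq_zero]
    refine jacobiPow_congr i n i (fun _ _ _ => rfl) fun k hk1 hk2 => ?_
    simp only [hs']
    rw [if_pos ⟨by linarith, by linarith⟩]
  have hle : ∀ i, |jacobiPow q s' i n i - jacobiPow q s i n i| ≤ 2 * (3 * C) ^ n := by
    intro i
    have h1 := abs_le.1 (abs_jacobiPow_le hqC hsC' i n i)
    have h2 := abs_le.1 (abs_jacobiPow_le hqC hsC i n i)
    rw [abs_le]
    constructor <;> linarith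
  have hcard : (S.card : ℝ) ≤ 2 * (n + 1) := by
    have h1 := Finset.card_union_le (Finset.Icc (-K : ℤ) (-K + n)) (Finset.Icc (K - n : ℤ) K)
    rw [← hS] at h1
    rw [Int.card_Icc, Int.card_Icc] at h1
    have h2 : S.card ≤ 2 * (n + 1) := by omega
    exact_mod_cast h2
  calc |∑ i ∈ Finset.Icc (-(K : ℤ)) K, (jacobiPow q s' i n i - jacobiPow q s i n i)|
      ≤ ∑ i ∈ Finset.Icc (-(K : ℤ)) K, |jacobiPow q s' i n i - jacobiPow q s i n i| :=
        Finset.abs_sum_le_sum_abs _ _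
    _ ≤ ∑ i ∈ S, |jacobiPow q s' i n i - jacobiPow q s i n i| := by
        rw [← Finset.sum_filter_of_ne (p := (· ∈ S)) fun i hi h => ?_]
        · exact Finset.sum_le_sum_of_subset_of_nonneg
            (fun i hi => (Finset.mem_filter.1 hi).2) fun _ _ _ => abs_nonneg _
        · by_contra hiS
          exact h (by rw [hzero i hi hiS, abs_zero])
    _ ≤ S.card * (2 * (3 * C) ^ n) := by
        rw [← nsmul_eq_mul]
        exact Finset.sum_le_card_nsmul _ _ _ fun i _ => hle i
    _ ≤ 2 * (n + 1) * (2 * (3 * C) ^ n) := by gcongr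
    _ = 4 * (n + 1) * (3 * C) ^ n := by ring

end Truncation

/-! ### Averages along subsequences -/

/-- If the partial sums `S n` have bounded increments, and `S (t m) ~ a m`, `t m ~ c m` along a
sequence of times `t` with bounded gaps, then `S n / n` converges to `a / c`. -/
theorem tendsto_div_of_tendsto_div_subseq {S : ℕ → ℝ} {t : ℕ → ℕ} {C : ℝ} {L : ℕ} {a c : ℝ}
    (hS : ∀ n, |S (n + 1) - S n| ≤ C) (ht0 : t 0 = 0) (ht : ∀ m, t m < t (m + 1))
    (htL : ∀ m, t (m + 1) ≤ t m + L) (hc : 0 < c)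
    (hat : Tendsto (fun m => S (t m) / m) atTop (𝓝 a))
    (hct : Tendsto (fun m => (t m : ℝ) / m) atTop (𝓝 c)) :
    Tendsto (fun n => S n / n) atTop (𝓝 (a / c)) := by
  have hC : 0 ≤ C := (abs_nonneg _).trans (hS 0)
  set b : ℝ := a / c with hb
  -- subtract the linear function with slope `b`, so that the limits become zero
  set R : ℕ → ℝ := fun n => S n - b * n with hR
  set C' : ℝ := C + |b| with hC'
  have hC'0 : 0 ≤ C' := by positivity
  have hRinc : ∀ n, |R (n + 1) - R n| ≤ C' := by
    intro n
    have h : R (n + 1) - R n = (S (n + 1) - S n) - b := by simp only [hR]; push_cast; ring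
    rw [h]
    exact (abs_sub _ _).trans (add_le_add_left (hS n) _)
  have hRd : ∀ n k, |R (n + k) - R n| ≤ C' * k := by
    intro n k
    induction k with
    | zero => simp
    | succ k ih =>
      have h1 := abs_le.1 ih
      have h2 := abs_le.1 (hRinc (n + k))
      rw [← add_assoc, abs_le]
      push_cast
      constructor <;> linarith
  have hRt : Tendsto (fun m => R (t m) / m) atTop (𝓝 0) := by
    have h := hat.sub (hct.const_mul b)
    have h0 : a - b * c = 0 := by rw [hb, div_mul_cancel₀ _ hc.ne', sub_self]
    rw [h0] at h
    refine h.congr fun m => ?_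
    simp only [hR]
    ring
  -- every `n` comes at most `L` after some `t m`, and then `m ≤ n` since `t` is strictly increasing
  have hex : ∀ n, ∃ m, m ≤ n ∧ t m ≤ n ∧ n ≤ t m + L := by
    intro n
    induction n with
    | zero => exact ⟨0, le_rfl, ht0.le, by omega⟩
    | succ n ih =>
      obtain ⟨m, h1, h2, h3⟩ := ih
      by_cases h : n + 1 ≤ t m + L
      · exact ⟨m, by omega, by omega, h⟩
      · have := htL m
        have := ht m
        exact ⟨m + 1, by omega, by omega, by omega⟩
  have hRn : Tendsto (fun n : ℕ => R n / n) atTop (𝓝 0) := by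
    rw [Metric.tendsto_atTop]
    intro ε hε
    obtain ⟨m₀, hm₀⟩ := Metric.tendsto_atTop.1 hRt (ε / 2) (by positivity)
    obtain ⟨A, hA⟩ : ∃ A : ℝ, 0 ≤ A ∧ ∀ m, |R (t m)| ≤ ε / 2 * m + A := by
      refine ⟨∑ m ∈ Finset.range (m₀ + 1), |R (t m)|, Finset.sum_nonneg fun _ _ => abs_nonneg _,
        fun m => ?_⟩
      have hsum : 0 ≤ ∑ m ∈ Finset.range (m₀ + 1), |R (t m)| :=
        Finset.sum_nonneg fun _ _ => abs_nonneg _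
      by_cases h : m ≤ m₀
      · have h1 := Finset.single_le_sum (f := fun m => |R (t m)|) (fun _ _ => abs_nonneg _)
          (Finset.mem_range.2 (Nat.lt_succ_of_le h))
        have h2 : 0 ≤ ε / 2 * m := by positivity
        linarith
      · have h1 := hm₀ m (by omega)
        have h2 : (0 : ℝ) < m := by exact_mod_cast (by omega : 0 < m)
        rw [dist_zero_right, Real.norm_eq_abs, abs_div, Nat.abs_cast, div_lt_iff₀ h2] at h1
        linarith
    obtain ⟨n₀, hn₀⟩ := exists_nat_gt (2 * (A + C' * L) / ε)
    refine ⟨n₀ + 1, fun n hn => ?_⟩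
    obtain ⟨m, h1, h2, h3⟩ := hex n
    obtain ⟨k, rfl⟩ := Nat.exists_eq_add_of_le h2
    have hn0 : (0 : ℝ) < ((t m + k : ℕ) : ℝ) := by exact_mod_cast (by omega : 0 < t m + k)
    rw [dist_zero_right, Real.norm_eq_abs, abs_div, Nat.abs_cast, div_lt_iff₀ hn0]
    have h4 := hRd (t m) k
    have h5 : C' * k ≤ C' * L := by
      have : k ≤ L := by omega
      gcongr
    have h6 : ε / 2 * m ≤ ε / 2 * ((t m + k : ℕ) : ℝ) := by gcongr
    have h7 : A + C' * L < ε / 2 * ((t m + k : ℕ) : ℝ) := by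
      rw [div_lt_iff₀ hε] at hn₀
      have : (n₀ : ℝ) ≤ ((t m + k : ℕ) : ℝ) := by exact_mod_cast (by omega : n₀ ≤ t m + k)
      nlinarith
    have h8 := abs_le.1 (hA.2 m)
    have h9 := abs_le.1 h4
    rw [abs_lt]
    constructor <;> linarith
  have := hRn.add_const b
  rw [zero_add] at this
  refine this.congr' ?_
  filter_upwards [eventually_gt_atTop 0] with n hn
  have hn' : (n : ℝ) ≠ 0 := by exact_mod_cast hn.ne'
  simp only [hR]
  field_simp
  ring

/-! ### A strong law for local functions of the block sequence -/

variable {D : ℕ}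

/-- Translates of a local function by more than its range are independent. -/
theorem indepFun_comp_shift (p : PMF (Fin D)) {G : (ℤ → Fin D) → ℝ} {W : ℕ}
    (hG : ∀ χ χ' : ℤ → Fin D, (∀ i : ℤ, |i| ≤ W → χ i = χ' i) → G χ = G χ') {a b : ℤ}
    (hab : 2 * (W : ℤ) < |a - b|) :
    ProbabilityTheory.IndepFun (fun χ => G (shift a χ)) (fun χ => G (shift b χ)) (blockLaw p) := by
  obtain ⟨d₀, -⟩ := p.support_nonempty
  have hind : ProbabilityTheory.iIndepFun (fun (i : ℤ) (χ : ℤ → Fin D) => χ i) (blockLaw p) :=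
    ProbabilityTheory.iIndepFun_infinitePi (P := fun _ : ℤ => p.toMeasure)
      (X := fun _ x => x) (fun _ => measurable_id)
  have hdisj : Disjoint (Finset.Icc (a - W) (a + W)) (Finset.Icc (b - W) (b + W)) := by
    rw [Finset.disjoint_left]
    intro x hx hx'
    rw [Finset.mem_Icc] at hx hx'
    rcases abs_cases (a - b) with h | h <;> omega
  have h := hind.indepFun_finset _ _ hdisj fun i => measurable_pi_apply i
  -- `G ∘ shift c` as a function of the coordinates in `[c - W, c + W]`
  have hfac : ∀ c : ℤ, ∃ φ : ((Finset.Icc (c - W) (c + W) : Finset ℤ) → Fin D) → ℝ, Measurable φ ∧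
      (fun χ => G (shift c χ)) = φ ∘ fun χ i => χ i := by
    intro c
    let ext : ((Finset.Icc (c - W) (c + W) : Finset ℤ) → Fin D) → ℤ → Fin D := fun x i =>
      if h : i ∈ Finset.Icc (c - W) (c + W) then x ⟨i, h⟩ else d₀
    refine ⟨fun x => G (shift c (ext x)), Measurable.of_discrete, ?_⟩
    funext χ
    refine hG _ _ fun i hi => ?_
    have hi' := abs_le.1 hi
    have hmem : i + c ∈ Finset.Icc (c - W) (c + W) := Finset.mem_Icc.2 ⟨by linarith, by linarith⟩
    simp only [shift, ext, dif_pos hmem]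
  obtain ⟨φ, hφ, h1⟩ := hfac a
  obtain ⟨ψ, hψ, h2⟩ := hfac b
  rw [h1, h2]
  exact h.comp hφ hψ

/-- A strong law of large numbers for the shifts of a local function: the shifts along a residue
class modulo `2 W + 1` are independent. -/
theorem strong_law_local (p : PMF (Fin D)) {G : (ℤ → Fin D) → ℝ} (hGm : Measurable G) {C : ℝ}
    (hGC : ∀ χ, |G χ| ≤ C) {W : ℕ}
    (hG : ∀ χ χ' : ℤ → Fin D, (∀ i : ℤ, |i| ≤ W → χ i = χ' i) → G χ = G χ') {τ : ℕ → ℤ}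
    (hτ : ∀ i j : ℕ, |τ i - τ j| = |(i : ℤ) - j|) :
    ∀ᵐ χ ∂(blockLaw p), Tendsto (fun n : ℕ => (∑ j ∈ Finset.range n, G (shift (τ j) χ)) / n) atTop
      (𝓝 (∫ χ, G χ ∂(blockLaw p))) := by
  set b : ℕ := 2 * W + 1 with hb
  set E : ℝ := ∫ χ, G χ ∂(blockLaw p)
  have hres : ∀ r : ℕ, ∀ᵐ χ ∂(blockLaw p), Tendsto
      (fun n : ℕ => (n : ℝ)⁻¹ • ∑ i ∈ Finset.range n, G (shift (τ (b * i + r)) χ)) atTop (𝓝 E) := by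
    intro r
    have hid : ∀ k : ℤ, ProbabilityTheory.IdentDistrib (fun χ => G (shift k χ)) G
        (blockLaw p) (blockLaw p) := by
      intro k
      refine ⟨(hGm.comp (measurable_shift k)).aemeasurable, hGm.aemeasurable, ?_⟩
      have := (measurePreserving_shift_blockLaw p k).map_eq
      conv_rhs => rw [← this, Measure.map_map hGm (measurable_shift k)]
      rfl
    have hint : ∀ k : ℤ, Integrable (fun χ => G (shift k χ)) (blockLaw p) := fun k =>
      Integrable.of_bound (hGm.comp (measurable_shift k)).aestronglyMeasurable C
        (Eventually.of_forall fun χ => hGC _)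
    have h := ProbabilityTheory.strong_law_ae (μ := blockLaw p)
      (fun i χ => G (shift (τ (b * i + r)) χ)) (hint _) ?_
      (fun i => (hid _).trans (hid _).symm)
    · rwa [(hid _).integral_eq] at h
    · intro i j hij
      refine indepFun_comp_shift p hG ?_
      rw [hτ]
      push_cast
      have h1 : ((b : ℤ) * i + r - (b * j + r)) = b * (i - j) := by ring
      have h2 : (1 : ℤ) ≤ |(i : ℤ) - j| := Int.one_le_abs (by omega)
      rw [h1, abs_mul, Nat.abs_cast, hb]
      push_cast
      nlinarith
  filter_upwards [ae_all_iff.2 hres] with χ hχ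
  have hsum := tendsto_finsetSum (Finset.range b) fun r _ => hχ r
  have hb0 : (0 : ℝ) < b := by simp only [hb]; positivity
  have hlim : (∑ r ∈ Finset.range b, E) / b = E := by
    rw [Finset.sum_const, Finset.card_range, nsmul_eq_mul, mul_div_cancel_left₀ _ hb0.ne']
  rw [← hlim]
  refine tendsto_div_of_tendsto_div_subseq (t := fun m => b * m) (C := C) (L := b) ?_ (by simp)
    ?_ ?_ hb0 (hsum.congr fun m => ?_) ?_
  · intro n
    rw [Finset.sum_range_succ, add_sub_cancel_left]
    exact hGC _
  · intro m
    simp only [hb]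
    nlinarith
  · intro m
    rw [mul_add, mul_one]
  · rw [← Finset.smul_sum, smul_eq_mul, inv_mul_eq_div]
    congr 1
    rw [Finset.sum_comm]
    induction m with
    | zero => simp
    | succ m ih =>
      rw [Finset.sum_range_succ, ih, mul_add, mul_one, Finset.sum_range_add _ (b * m) b]
  · refine tendsto_const_nhds.congr' ?_
    filter_upwards [eventually_gt_atTop 0] with n hn
    have hn' : (n : ℝ) ≠ 0 := by exact_mod_cast hn.ne'
    push_cast
    rw [mul_div_cancel_right₀ _ hn']

/-! ### Local functions of the resonator sequence -/

theorem measurableSingletonClass_index (B : BlockSystem D) : MeasurableSingletonClass B.Index :=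
  ⟨fun x => MeasurableSpace.measurableSet_iInf.2 fun d =>
    (MeasurableSet.of_discrete : MeasurableSet (Sigma.mk d ⁻¹' {x}))⟩

/-- A function of a sequence over a finite alphabet that depends only on finitely many coordinates
is measurable. -/
theorem measurable_of_local {α : Type*} [Finite α] [MeasurableSpace α] [MeasurableSingletonClass α]
    {g : (ℤ → α) → ℝ} {w : ℕ} (hg : ∀ μ μ' : ℤ → α, (∀ i : ℤ, |i| ≤ w → μ i = μ' i) → g μ = g μ') :
    Measurable g := by
  rcases isEmpty_or_nonempty α with h | ⟨⟨a⟩⟩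
  · exact measurable_of_empty g
  let ext : ((Finset.Icc (-w : ℤ) w : Finset ℤ) → α) → ℤ → α := fun x i =>
    if h : i ∈ Finset.Icc (-w : ℤ) w then x ⟨i, h⟩ else a
  have h : g = (fun x => g (ext x)) ∘ fun μ i => μ i := by
    funext μ
    refine hg _ _ fun i hi => ?_
    simp only [ext, dif_pos (Finset.mem_Icc.2 (abs_le.1 hi))]
  rw [h]
  exact Measurable.of_discrete.comp (measurable_pi_lambda _ fun i => measurable_pi_apply _)

theorem index_ext {B : BlockSystem D} {a b : B.Index} (h1 : a.1 = b.1) (h2 : (a.2 : ℕ) = b.2) :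
    a = b := by
  obtain ⟨d, r⟩ := a
  obtain ⟨d', r'⟩ := b
  obtain rfl : d = d' := h1
  congr 1
  exact Fin.ext h2

/-- The first `n` resonators on either side of the origin lie in the first `n` blocks. -/
theorem placeOf_local (B : BlockSystem D) {χ χ' : ℤ → Fin D} {n : ℕ}
    (h : ∀ i : ℤ, |i| ≤ n → χ i = χ' i) (i : ℤ) (hi : |i| ≤ n) :
    (placeOf B χ i).1 = (placeOf B χ' i).1 ∧ |(placeOf B χ i).1.1| ≤ |i| := by
  induction i using Int.induction_on with
  | zero => exact ⟨rfl, le_rfl⟩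
  | succ i ih =>
    have e0 : |(i : ℤ) + 1| = i + 1 := abs_of_nonneg (by positivity)
    have e1 : |(i : ℤ)| = i := Nat.abs_cast i
    rw [e0] at hi ⊢
    rw [e1] at ih
    obtain ⟨h1, h2⟩ := ih (by linarith)
    rw [placeOf_add_one, placeOf_add_one]
    generalize placeOf B χ i = x at h1 h2 ⊢
    generalize placeOf B χ' i = x' at h1 ⊢
    obtain ⟨⟨j, r⟩, hr⟩ := x
    obtain ⟨⟨j', r'⟩, hr'⟩ := x'
    simp only [Prod.mk.injEq] at h1 h2
    obtain ⟨rfl, rfl⟩ := h1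
    have h3 := h j (h2.trans (by linarith))
    have h4 := abs_le.1 h2
    simp only [nextPlace, Equiv.coe_fn_mk, h3]
    split_ifs
    · exact ⟨rfl, h2.trans (by linarith)⟩
    · exact ⟨rfl, abs_le.2 ⟨by linarith, by linarith⟩⟩
  | pred i ih =>
    have e0 : |-(i : ℤ) - 1| = i + 1 := by rw [abs_of_nonpos (by linarith)]; ring
    have e1 : |-(i : ℤ)| = i := by rw [abs_neg, Nat.abs_cast]
    rw [e0] at hi ⊢
    rw [e1] at ih
    obtain ⟨h1, h2⟩ := ih (by linarith)
    rw [placeOf_sub_one, placeOf_sub_one]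
    generalize placeOf B χ (-i) = x at h1 h2 ⊢
    generalize placeOf B χ' (-i) = x' at h1 ⊢
    obtain ⟨⟨j, r⟩, hr⟩ := x
    obtain ⟨⟨j', r'⟩, hr'⟩ := x'
    simp only [Prod.mk.injEq] at h1 h2
    obtain ⟨rfl, rfl⟩ := h1
    have h4 := abs_le.1 h2
    have h5 : |j - 1| ≤ (i : ℤ) + 1 := abs_le.2 ⟨by linarith, by linarith⟩
    have h3 := h (j - 1) (h5.trans hi)
    simp only [nextPlace, Equiv.coe_fn_symm_mk, h3]
    split_ifs
    · exact ⟨rfl, h2.trans (by linarith)⟩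
    · exact ⟨rfl, h5⟩

theorem resonatorSequence_local (B : BlockSystem D) {χ χ' : ℤ → Fin D} {n : ℕ}
    (h : ∀ i : ℤ, |i| ≤ n → χ i = χ' i) (i : ℤ) (hi : |i| ≤ n) :
    resonatorSequence B χ i = resonatorSequence B χ' i := by
  obtain ⟨h1, h2⟩ := placeOf_local B h i hi
  refine index_ext ?_ (congrArg Prod.snd h1)
  change χ _ = χ' _
  rw [← h1]
  exact h _ (h2.trans hi)

theorem shift_shift {α : Type*} (a b : ℤ) (μ : ℤ → α) : shift a (shift b μ) = shift (b + a) μ := by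
  funext i
  simp only [shift]
  congr 1
  ring

/-- The sum of the translates of `g` over the resonators of the block with number `0`. -/
noncomputable def blockSum (B : BlockSystem D) (g : (ℤ → B.Index) → ℝ) (χ : ℤ → Fin D) : ℝ :=
  ∑ r ∈ Finset.range (B.len (χ 0)), g (shift (r : ℤ) (resonatorSequence B χ))

theorem len_le_sum (B : BlockSystem D) (d : Fin D) : B.len d ≤ ∑ d, B.len d :=
  Finset.single_le_sum (f := B.len) (fun _ _ => Nat.zero_le _) (Finset.mem_univ d)

theorem blockSum_local (B : BlockSystem D) {g : (ℤ → B.Index) → ℝ} {w : ℕ}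
    (hg : ∀ μ μ' : ℤ → B.Index, (∀ i : ℤ, |i| ≤ w → μ i = μ' i) → g μ = g μ') (χ χ' : ℤ → Fin D)
    (h : ∀ i : ℤ, |i| ≤ (w + ∑ d, B.len d : ℕ) → χ i = χ' i) :
    blockSum B g χ = blockSum B g χ' := by
  rw [blockSum, blockSum, ← h 0 (by rw [abs_zero]; positivity)]
  refine Finset.sum_congr rfl fun r hr => hg _ _ fun i hi => resonatorSequence_local B h _ ?_
  have h1 := Finset.mem_range.1 hr
  have h2 := len_le_sum B (χ 0)
  have h3 := abs_le.1 hi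
  rw [abs_le]
  push_cast
  zify at h1 h2
  constructor <;> linarith

theorem abs_blockSum_le (B : BlockSystem D) {g : (ℤ → B.Index) → ℝ} {C : ℝ} (hgC : ∀ μ, |g μ| ≤ C)
    (χ : ℤ → Fin D) : |blockSum B g χ| ≤ (∑ d, B.len d : ℕ) * C := by
  have hC : 0 ≤ C := (abs_nonneg _).trans (hgC (resonatorSequence B χ))
  calc |blockSum B g χ| ≤ ∑ r ∈ Finset.range (B.len (χ 0)), C :=
        (Finset.abs_sum_le_sum_abs _ _).trans (Finset.sum_le_sum fun _ _ => hgC _)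
    _ = B.len (χ 0) * C := by simp
    _ ≤ _ := by
        gcongr
        exact len_le_sum B (χ 0)

theorem blockSum_one (B : BlockSystem D) (χ : ℤ → Fin D) :
    blockSum B (fun _ => 1) χ = B.len (χ 0) := by
  simp [blockSum]

/-- Up to normalisation, the law of the resonator sequence integrates `g` by summing its translates
over the block at the origin. -/
theorem integral_resonatorLaw (B : BlockSystem D) (p : PMF (Fin D)) {g : (ℤ → B.Index) → ℝ}
    (hgm : Measurable g) {C : ℝ} (hgC : ∀ μ, |g μ| ≤ C) :
    ∫ μ, g μ ∂(resonatorLaw B p) =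
      (meanLength B p)⁻¹.toReal * ∫ χ, blockSum B g χ ∂(blockLaw p) := by
  have hm : ∀ k : ℤ, Measurable fun χ => shift k (resonatorSequence B χ) := fun k =>
    (measurable_shift _).comp (measurable_resonatorSequence B)
  have hint : ∀ k : ℤ, Integrable (fun χ => g (shift k (resonatorSequence B χ))) (blockLaw p) :=
    fun k => Integrable.of_bound (hgm.comp (hm k)).aestronglyMeasurable C
      (Eventually.of_forall fun χ => hgC _)
  have hd : ∀ d, MeasurableSet {χ : ℤ → Fin D | χ 0 = d} := fun d =>
    (measurable_pi_apply (X := fun _ : ℤ => Fin D) 0) (measurableSet_singleton d)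
  have hsum : ∀ χ, blockSum B g χ = ∑ a : B.Index,
      {χ : ℤ → Fin D | χ 0 = a.1}.indicator
        (fun χ => g (shift ((a.2 : ℕ) : ℤ) (resonatorSequence B χ))) χ := by
    intro χ
    rw [Fintype.sum_sigma, Finset.sum_eq_single (χ 0)]
    · rw [blockSum, Finset.sum_range]
      simp
    · intro d _ hne
      exact Finset.sum_eq_zero fun r _ => Set.indicator_of_notMem (by simpa using hne.symm) _
    · simp
  rw [resonatorLaw, integral_smul_measure, smul_eq_mul, integral_finsetSum_measure]
  · congr 1
    simp_rw [hsum]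
    rw [integral_finsetSum]
    · refine Finset.sum_congr rfl fun a _ => ?_
      rw [integral_map (hm _).aemeasurable hgm.aestronglyMeasurable, integral_indicator (hd _)]
    · exact fun a _ => (hint _).indicator (hd _)
  · intro a _
    exact Integrable.of_bound hgm.aestronglyMeasurable C (Eventually.of_forall fun χ => hgC _)

theorem resonatorSequence_shift_natCast (B : BlockSystem D) (χ : ℤ → Fin D) (m : ℕ) :
    resonatorSequence B (shift m χ) =
      shift ((∑ j ∈ Finset.range m, B.len (χ j) : ℕ) : ℤ) (resonatorSequence B χ) := by
  induction m with
  | zero =>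
    have h : ∀ {α : Type} (μ : ℤ → α), shift 0 μ = μ := fun μ => by funext i; simp [shift]
    simp [h]
  | succ m ih =>
    push_cast
    rw [← shift_shift, resonatorSequence_shift_one, ih, shift_shift, Finset.sum_range_succ]
    simp [shift]

theorem resonatorSequence_shift_neg_natCast (B : BlockSystem D) (χ : ℤ → Fin D) (m : ℕ) :
    resonatorSequence B (shift (-m) χ) =
      shift (-((∑ j ∈ Finset.range m, B.len (χ (-j - 1)) : ℕ) : ℤ)) (resonatorSequence B χ) := by
  have h0 : ∀ {α : Type} (μ : ℤ → α), shift 0 μ = μ := fun μ => by funext i; simp [shift]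
  induction m with
  | zero => simp [h0]
  | succ m ih =>
    have h1 := resonatorSequence_shift_one B (shift (-(m + 1 : ℕ)) χ)
    have e1 : (-((m + 1 : ℕ) : ℤ) + 1) = -m := by push_cast; ring
    rw [shift_shift, e1, ih] at h1
    have h2 := congrArg (shift (-(B.len (shift (-(m + 1 : ℕ)) χ 0) : ℤ))) h1
    rw [shift_shift, shift_shift, add_neg_cancel, h0] at h2
    rw [← h2, Finset.sum_range_succ]
    congr 1
    simp only [shift]
    push_cast
    rw [neg_add, zero_add, neg_add, sub_eq_add_neg]

theorem sum_blockSum_shift (B : BlockSystem D) (g : (ℤ → B.Index) → ℝ) (χ : ℤ → Fin D) (m : ℕ) :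
    ∑ i ∈ Finset.range (∑ j ∈ Finset.range m, B.len (χ j)),
      g (shift (i : ℤ) (resonatorSequence B χ)) =
      ∑ j ∈ Finset.range m, blockSum B g (shift (j : ℤ) χ) := by
  induction m with
  | zero => simp
  | succ m ih =>
    rw [Finset.sum_range_succ, Finset.sum_range_succ, Finset.sum_range_add, ih, blockSum,
      resonatorSequence_shift_natCast]
    congr 1
    simp only [shift_shift]
    simp [shift]

theorem sum_blockSum_shift_neg (B : BlockSystem D) (g : (ℤ → B.Index) → ℝ) (χ : ℤ → Fin D)
    (m : ℕ) :
    ∑ i ∈ Finset.range (∑ j ∈ Finset.range m, B.len (χ (-j - 1))),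
      g (shift (-i - 1 : ℤ) (resonatorSequence B χ)) =
      ∑ j ∈ Finset.range m, blockSum B g (shift (-j - 1 : ℤ) χ) := by
  induction m with
  | zero => simp
  | succ m ih =>
    have e1 : (-(m : ℤ) - 1) = -((m + 1 : ℕ) : ℤ) := by push_cast; ring
    have e2 : shift (-(m : ℤ) - 1) χ 0 = χ (-m - 1) := by simp [shift]
    rw [Finset.sum_range_succ _ m, Finset.sum_range_succ _ m, Finset.sum_range_add, ih]
    congr 1
    rw [blockSum, e2, ← Finset.sum_range_reflect]
    refine Finset.sum_congr rfl fun r hr => ?_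
    have hr' := Finset.mem_range.1 hr
    have e4 : resonatorSequence B (shift (-m - 1 : ℤ) χ) = _ :=
      (congrArg (fun k => resonatorSequence B (shift k χ)) e1).trans
        (resonatorSequence_shift_neg_natCast B χ (m + 1))
    rw [e4, shift_shift, Finset.sum_range_succ]
    congr 2
    have e3 : ((B.len (χ (-m - 1)) - 1 - r : ℕ) : ℤ) = B.len (χ (-m - 1)) - 1 - r := by omega
    push_cast
    rw [e3]
    ring

/-! ### The ergodic theorem for the resonator sequence -/

/-- The average of `a` over `[-K, K]`. -/
noncomputable def windowAverage (a : ℤ → ℝ) (K : ℕ) : ℝ :=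
  ((2 * K + 1 : ℕ) : ℝ)⁻¹ * ∑ i ∈ Finset.Icc (-(K : ℤ)) K, a i

theorem sum_Icc_eq (a : ℤ → ℝ) (K : ℕ) :
    ∑ i ∈ Finset.Icc (-(K : ℤ)) K, a i =
      ∑ i ∈ Finset.range (K + 1), a i + ∑ i ∈ Finset.range K, a (-i - 1) := by
  induction K with
  | zero => simp
  | succ K ih =>
    have h : Finset.Icc (-((K + 1 : ℕ) : ℤ)) (K + 1 : ℕ) =
        insert (-(K : ℤ) - 1) (insert ((K : ℤ) + 1) (Finset.Icc (-(K : ℤ)) K)) := by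
      ext i
      simp only [Finset.mem_insert, Finset.mem_Icc]
      omega
    rw [h, Finset.sum_insert, Finset.sum_insert, ih, Finset.sum_range_succ _ (K + 1),
      Finset.sum_range_succ (fun i : ℕ => a (-i - 1)) K]
    · push_cast; ring
    · simp
    · simp only [Finset.mem_insert, Finset.mem_Icc]
      omega

theorem tendsto_windowAverage {a : ℤ → ℝ} {l : ℝ}
    (h1 : Tendsto (fun n : ℕ => (∑ i ∈ Finset.range n, a i) / n) atTop (𝓝 l))
    (h2 : Tendsto (fun n : ℕ => (∑ i ∈ Finset.range n, a (-i - 1)) / n) atTop (𝓝 l)) :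
    Tendsto (windowAverage a) atTop (𝓝 l) := by
  have h3 : Tendsto (fun n : ℕ => (n : ℝ) / (2 * n + 1 : ℕ)) atTop (𝓝 (1 / 2)) := by
    have h := (tendsto_natCast_div_add_atTop (1 / 2 : ℝ)).mul_const (1 / 2 : ℝ)
    rw [one_mul] at h
    refine h.congr fun n => ?_
    push_cast
    field_simp
  have h4 : Tendsto (fun n : ℕ => ((n + 1 : ℕ) : ℝ) / (2 * n + 1 : ℕ)) atTop (𝓝 (1 / 2)) := by
    have h5 : Tendsto (fun n : ℕ => (1 : ℝ) - (n : ℝ) / (2 * n + 1 : ℕ)) atTop (𝓝 (1 - 1 / 2)) :=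
      h3.const_sub 1
    have e : (1 : ℝ) - 1 / 2 = 1 / 2 := by norm_num
    rw [e] at h5
    refine h5.congr fun n => ?_
    have : ((2 * n + 1 : ℕ) : ℝ) ≠ 0 := by positivity
    field_simp
    push_cast
    ring
  have h := (((tendsto_add_atTop_iff_nat 1).2 h1).mul h4).add (h2.mul h3)
  have e : l * (1 / 2) + l * (1 / 2) = l := by ring
  rw [e] at h
  refine h.congr' ?_
  filter_upwards [eventually_gt_atTop 0] with K hK
  rw [windowAverage, sum_Icc_eq, div_mul_div_cancel₀ (by positivity),
    div_mul_div_cancel₀ (by positivity), ← add_div, inv_mul_eq_div]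

theorem tendsto_windowAverage_shift_one {a : ℤ → ℝ} {l C : ℝ} (ha : ∀ i, |a i| ≤ C)
    (h : Tendsto (windowAverage a) atTop (𝓝 l)) :
    Tendsto (windowAverage fun i => a (i + 1)) atTop (𝓝 l) := by
  have hC : 0 ≤ C := (abs_nonneg _).trans (ha 0)
  have hbd : ∀ K : ℕ, |windowAverage (fun i => a (i + 1)) K - windowAverage a K| ≤
      (2 * C) / ((2 * K + 1 : ℕ) : ℝ) := by
    intro K
    have e : ∑ i ∈ Finset.Icc (-(K : ℤ)) K, a (i + 1) =
        ∑ i ∈ Finset.Icc (-(K : ℤ)) K, a i + a (K + 1) - a (-K) := by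
      have h1 : ∑ i ∈ Finset.Icc (-(K : ℤ)) K, a (i + 1) =
          ∑ i ∈ Finset.Icc (-(K : ℤ) + 1) (K + 1), a i := by
        rw [← Finset.map_add_right_Icc, Finset.sum_map]
        rfl
      have h2 : insert (-(K : ℤ)) (Finset.Icc (-(K : ℤ) + 1) (K + 1)) =
          insert ((K : ℤ) + 1) (Finset.Icc (-(K : ℤ)) K) := by
        ext i
        simp only [Finset.mem_insert, Finset.mem_Icc]
        omega
      have h3 := congrArg (fun S => ∑ i ∈ S, a i) h2
      rw [Finset.sum_insert (by simp), Finset.sum_insert (by simp)] at h3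
      rw [h1]
      linarith
    have h1 := abs_le.1 (ha (K + 1))
    have h2 := abs_le.1 (ha (-K))
    rw [windowAverage, windowAverage, ← mul_sub, e, abs_mul, abs_of_nonneg (by positivity),
      inv_mul_eq_div]
    gcongr
    rw [abs_le]
    constructor <;> linarith
  have hz : Tendsto (fun K : ℕ => (2 * C) / ((2 * K + 1 : ℕ) : ℝ)) atTop (𝓝 0) := by
    refine tendsto_const_nhds.div_atTop (tendsto_natCast_atTop_atTop.comp ?_)
    exact tendsto_atTop_mono (fun K : ℕ => (by omega : K ≤ 2 * K + 1)) tendsto_id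
  have := (squeeze_zero_norm hbd hz).add h
  rw [zero_add] at this
  exact this.congr fun K => by ring

/-- The averages of a local function along the resonator sequence of i.i.d. blocks converge. -/
theorem ae_blockLaw_tendsto_windowAverage (B : BlockSystem D) (p : PMF (Fin D))
    {g : (ℤ → B.Index) → ℝ} {C : ℝ} (hgC : ∀ μ, |g μ| ≤ C) {w : ℕ}
    (hg : ∀ μ μ' : ℤ → B.Index, (∀ i : ℤ, |i| ≤ w → μ i = μ' i) → g μ = g μ') :
    ∀ᵐ χ ∂(blockLaw p), Tendsto (windowAverage fun i => g (shift i (resonatorSequence B χ))) atTop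
      (𝓝 (∫ μ, g μ ∂(resonatorLaw B p))) := by
  have := measurableSingletonClass_index B
  have hgm : Measurable g := measurable_of_local hg
  -- the mean of the block sum over the mean length is the integral against the resonator law
  set El : ℝ := ∫ χ, blockSum B (fun _ => 1) χ ∂(blockLaw p) with hEl
  have hone := integral_resonatorLaw B p (g := fun _ => 1) measurable_const (C := 1) (by simp)
  rw [integral_const, probReal_univ, one_smul] at hone
  have hElpos : 0 < El := by
    have h1 : 0 ≤ El := integral_nonneg fun χ => by rw [blockSum_one]; positivity
    exact lt_of_le_of_ne h1 fun h => by rw [← hEl, ← h, mul_zero] at hone; exact one_ne_zero hone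
  have hlim : ∫ μ, g μ ∂(resonatorLaw B p) = (∫ χ, blockSum B g χ ∂(blockLaw p)) / El := by
    rw [integral_resonatorLaw B p hgm hgC, eq_div_iff hElpos.ne']
    calc _ = ((meanLength B p)⁻¹.toReal * El) * ∫ χ, blockSum B g χ ∂(blockLaw p) := by ring
      _ = _ := by rw [← hone, one_mul]
  have hτ1 : ∀ i j : ℕ, |(i : ℤ) - j| = |(i : ℤ) - j| := fun _ _ => rfl
  have hτ2 : ∀ i j : ℕ, |(-i - 1 : ℤ) - (-j - 1)| = |(i : ℤ) - j| := fun i j => by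
    rw [abs_sub_comm (i : ℤ)]; congr 1; ring
  have hloc := blockSum_local B hg
  have hloc1 := blockSum_local B (g := fun _ => 1) (w := 0) (fun _ _ _ => rfl)
  have hC1 := abs_blockSum_le B (g := fun _ => 1) (C := 1) (by simp)
  have hm := measurable_of_local hloc
  have hm1 := measurable_of_local hloc1
  filter_upwards [strong_law_local p hm (abs_blockSum_le B hgC) hloc hτ1,
    strong_law_local p hm (abs_blockSum_le B hgC) hloc hτ2,
    strong_law_local p hm1 hC1 hloc1 hτ1, strong_law_local p hm1 hC1 hloc1 hτ2] with χ h1 h2 h3 h4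
  rw [hlim]
  have hlen : ∀ k : ℤ, blockSum B (fun _ => 1) (shift k χ) = B.len (χ k) := fun k => by
    rw [blockSum_one]; simp [shift]
  simp only [hlen] at h3 h4
  refine tendsto_windowAverage ?_ ?_
  · refine tendsto_div_of_tendsto_div_subseq (C := C) (L := ∑ d, B.len d)
      (t := fun m => ∑ j ∈ Finset.range m, B.len (χ j)) (fun n => ?_) (by simp) (fun m => ?_)
      (fun m => ?_) hElpos ?_ ?_
    · rw [Finset.sum_range_succ, add_sub_cancel_left]
      exact hgC _
    · rw [Finset.sum_range_succ]
      exact Nat.lt_add_of_pos_right (B.len_pos _)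
    · rw [Finset.sum_range_succ]
      exact Nat.add_le_add_left (len_le_sum B _) _
    · simp only [sum_blockSum_shift]
      exact h1
    · push_cast
      exact h3
  · refine tendsto_div_of_tendsto_div_subseq (C := C) (L := ∑ d, B.len d)
      (t := fun m => ∑ j ∈ Finset.range m, B.len (χ (-j - 1))) (fun n => ?_) (by simp) (fun m => ?_)
      (fun m => ?_) hElpos ?_ ?_
    · rw [Finset.sum_range_succ, add_sub_cancel_left]
      exact hgC _
    · rw [Finset.sum_range_succ]
      exact Nat.lt_add_of_pos_right (B.len_pos _)
    · rw [Finset.sum_range_succ]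
      exact Nat.add_le_add_left (len_le_sum B _) _
    · simp only [sum_blockSum_shift_neg]
      exact h2
    · push_cast
      exact h4

/-- The resonator law is a mixture of laws of shifted block arrays, and bounded shifts do not change
the limits of averages. -/
theorem ae_resonatorLaw_tendsto_windowAverage (B : BlockSystem D) (p : PMF (Fin D))
    {g : (ℤ → B.Index) → ℝ} {C : ℝ} (hgC : ∀ μ, |g μ| ≤ C) {w : ℕ}
    (hg : ∀ μ μ' : ℤ → B.Index, (∀ i : ℤ, |i| ≤ w → μ i = μ' i) → g μ = g μ') :
    ∀ᵐ μ ∂(resonatorLaw B p), Tendsto (windowAverage fun i => g (shift i μ)) atTop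
      (𝓝 (∫ μ, g μ ∂(resonatorLaw B p))) := by
  have := measurableSingletonClass_index B
  have hgm : Measurable g := measurable_of_local hg
  set l := ∫ μ, g μ ∂(resonatorLaw B p)
  have hmeas : MeasurableSet {μ : ℤ → B.Index |
      Tendsto (windowAverage fun i => g (shift i μ)) atTop (𝓝 l)} := by
    refine measurableSet_tendsto (𝓝 l) fun K => ?_
    simp only [windowAverage]
    exact (Finset.measurable_fun_sum _ fun i _ => hgm.comp (measurable_shift i)).const_mul _
  have hshift : ∀ (χ : ℤ → Fin D) (r : ℕ),
      Tendsto (windowAverage fun i => g (shift i (resonatorSequence B χ))) atTop (𝓝 l) →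
      Tendsto (windowAverage fun i => g (shift i (shift (r : ℤ) (resonatorSequence B χ)))) atTop
        (𝓝 l) := by
    intro χ r h
    induction r with
    | zero =>
      simp only [shift_shift]
      simpa using h
    | succ r ih =>
      refine (tendsto_windowAverage_shift_one (fun i => hgC _) ih).congr fun K => ?_
      simp only [shift_shift]
      congr 1
      funext i
      congr 2
      push_cast
      ring
  rw [resonatorLaw]
  refine Measure.ae_smul_measure ?_ _
  rw [ae_finsetSum_measure_iff]
  intro a _
  have hm : Measurable fun χ => shift ((a.2 : ℕ) : ℤ) (resonatorSequence B χ) :=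
    (measurable_shift _).comp (measurable_resonatorSequence B)
  rw [ae_map_iff hm.aemeasurable hmeas]
  refine ae_restrict_of_ae ?_
  filter_upwards [ae_blockLaw_tendsto_windowAverage B p hgC hg] with χ hχ
  exact hshift χ _ hχ

/-! ### The random Jacobi operator -/

theorem exists_bound_entries (B : BlockSystem D) :
    ∃ C : ℝ, 0 ≤ C ∧ ∀ (μ : ℤ → B.Index) (i : ℤ),
      |diagEntry B μ i| ≤ C ∧ |offDiagEntry B μ i| ≤ C := by
  let F : B.Index × B.Index → ℝ := fun x =>
    |(B.res x.2.1 x.2.2).speed ^ 2 / (B.res x.2.1 x.2.2).length *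
      (1 / (B.res x.1.1 x.1.2).spacing + 1 / (B.res x.2.1 x.2.2).spacing)|
  let F' : B.Index × B.Index → ℝ := fun x =>
    |(B.res x.1.1 x.1.2).speed * (B.res x.2.1 x.2.2).speed /
      ((B.res x.1.1 x.1.2).spacing *
        Real.sqrt ((B.res x.1.1 x.1.2).length * (B.res x.2.1 x.2.2).length))|
  have hF : ∀ x, 0 ≤ F x := fun x => abs_nonneg _
  have hF' : ∀ x, 0 ≤ F' x := fun x => abs_nonneg _
  refine ⟨∑ x, (F x + F' x), Finset.sum_nonneg fun x _ => add_nonneg (hF x) (hF' x),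
    fun μ i => ?_⟩
  have h := Finset.single_le_sum (f := fun x => F x + F' x)
    (fun x _ => add_nonneg (hF x) (hF' x)) (Finset.mem_univ (μ (i - 1), μ i))
  exact ⟨(le_add_of_nonneg_right (hF' _)).trans h, (le_add_of_nonneg_left (hF _)).trans h⟩

theorem offDiagEntry_ne_zero (B : BlockSystem D) (μ : ℤ → B.Index) (i : ℤ) :
    offDiagEntry B μ i ≠ 0 := by
  have h1 := fun k => (B.res (μ k).1 (μ k).2).speed_pos
  have h2 := fun k => (B.res (μ k).1 (μ k).2).length_pos
  have h3 := fun k => (B.res (μ k).1 (μ k).2).spacing_pos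
  exact (div_pos (mul_pos (h1 _) (h1 _))
    (mul_pos (h3 _) (Real.sqrt_pos.2 (mul_pos (h2 _) (h2 _))))).ne'

/-- The moment `⟨e₀, J(μ)ⁿ e₀⟩` of the spectral measure at the origin. -/
noncomputable def moment (B : BlockSystem D) (n : ℕ) (μ : ℤ → B.Index) : ℝ :=
  jacobiPow (diagEntry B μ) (offDiagEntry B μ) 0 n 0

theorem moment_local (B : BlockSystem D) (n : ℕ) (μ μ' : ℤ → B.Index)
    (h : ∀ i : ℤ, |i| ≤ (n + 1 : ℕ) → μ i = μ' i) : moment B n μ = moment B n μ' := by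
  have h' : ∀ i : ℤ, -n - 1 ≤ i → i ≤ n + 1 → μ i = μ' i := fun i h1 h2 =>
    h i (abs_le.2 ⟨by push_cast; linarith, by push_cast; linarith⟩)
  refine jacobiPow_congr 0 n 0 (fun k h1 h2 => ?_) (fun k h1 h2 => ?_)
  · simp only [diagEntry]
    rw [h' k (by linarith) (by linarith), h' (k - 1) (by linarith) (by linarith)]
  · simp only [offDiagEntry]
    rw [h' k (by linarith) (by linarith), h' (k - 1) (by linarith) (by linarith)]

theorem moment_shift (B : BlockSystem D) (n : ℕ) (μ : ℤ → B.Index) (i : ℤ) :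
    moment B n (shift i μ) = jacobiPow (diagEntry B μ) (offDiagEntry B μ) i n i := by
  have h := jacobiPow_translate (diagEntry B μ) (offDiagEntry B μ) 0 i n 0
  rw [zero_add] at h
  rw [h, moment]
  have e : ∀ l : ℤ, l - 1 + i = l + i - 1 := fun l => by ring
  congr 1
  · funext l
    simp only [diagEntry, shift]
    rw [e]
  · funext l
    simp only [offDiagEntry, shift]
    rw [e]

theorem isSelfAdjoint_J (B : BlockSystem D) (μ : ℤ → B.Index) : IsSelfAdjoint (J B μ) :=
  isSelfAdjoint_jacobiOperator _ _

theorem norm_e (i : ℤ) : ‖e i‖ = 1 := orthonormal_e.1 i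

instance (B : BlockSystem D) (μ : ℤ → B.Index) (i : ℤ) :
    IsProbabilityMeasure (spectralMeasure (J B μ) (e i)) :=
  isProbabilityMeasure_spectralMeasure (isSelfAdjoint_J B μ) (norm_e i)

theorem integral_pow_spectralMeasure_J (B : BlockSystem D) (μ : ℤ → B.Index) (i : ℤ) (n : ℕ) :
    ∫ x, x ^ n ∂(spectralMeasure (J B μ) (e i)) = moment B n (shift i μ) := by
  rw [integral_pow_spectralMeasure (isSelfAdjoint_J B μ), inner_e_left, moment_shift, J,
    jacobiOperator_pow_apply_e, Complex.ofReal_re]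

theorem spectralMeasure_J_compl_Icc (B : BlockSystem D) {C : ℝ}
    (hC : ∀ (μ : ℤ → B.Index) (i : ℤ), |diagEntry B μ i| ≤ C ∧ |offDiagEntry B μ i| ≤ C)
    (μ : ℤ → B.Index) (i : ℤ) :
    spectralMeasure (J B μ) (e i) (Set.Icc (-(3 * C)) (3 * C))ᶜ = 0 :=
  spectralMeasure_compl_Icc (isSelfAdjoint_J B μ) _
    (norm_jacobiOperator_le (fun i => (hC μ i).1) fun i => (hC μ i).2)

/-- Covariance under shifts: both measures have the same moments. -/
theorem spectralMeasure_J_shift (B : BlockSystem D) (μ : ℤ → B.Index) (i : ℤ) :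
    spectralMeasure (J B (shift i μ)) (e 0) = spectralMeasure (J B μ) (e i) := by
  obtain ⟨C, -, hC⟩ := exists_bound_entries B
  refine ext_of_moments (spectralMeasure_J_compl_Icc B hC _ _)
    (spectralMeasure_J_compl_Icc B hC _ _) fun k => ?_
  rw [integral_pow_spectralMeasure_J, integral_pow_spectralMeasure_J, shift_shift, add_zero]

theorem abs_moment_le (B : BlockSystem D) {C : ℝ}
    (hC : ∀ (μ : ℤ → B.Index) (i : ℤ), |diagEntry B μ i| ≤ C ∧ |offDiagEntry B μ i| ≤ C) (n : ℕ)
    (μ : ℤ → B.Index) : |moment B n μ| ≤ (3 * C) ^ n :=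
  abs_jacobiPow_le (fun i => (hC μ i).1) (fun i => (hC μ i).2) _ _ _

theorem measurable_moment (B : BlockSystem D) (n : ℕ) : Measurable (moment B n) := by
  have := measurableSingletonClass_index B
  exact measurable_of_local (moment_local B n)

/-- The integral of `f` is a limit of integrals of polynomials, which are linear combinations of
moments and hence local functions of `μ`. -/
theorem measurable_integral_spectralMeasure_J (B : BlockSystem D) {f : ℝ → ℝ} (hf : Continuous f) :
    Measurable fun μ => ∫ x, f x ∂(spectralMeasure (J B μ) (e 0)) := by
  obtain ⟨C, -, hC⟩ := exists_bound_entries B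
  have hsupp := fun μ => spectralMeasure_J_compl_Icc B hC μ 0
  choose q hq using fun n : ℕ => exists_polynomial_near_of_continuousOn (-(3 * C)) (3 * C) f
    hf.continuousOn (1 / ((n : ℝ) + 1)) (by positivity)
  refine measurable_of_tendsto_metrizable (f := fun n μ =>
    ∫ x, (q n).eval x ∂(spectralMeasure (J B μ) (e 0))) (fun n => ?_) ?_
  · have h : ∀ μ, ∫ x, (q n).eval x ∂(spectralMeasure (J B μ) (e 0)) =
        ∑ k ∈ Finset.range ((q n).natDegree + 1), (q n).coeff k * moment B k (shift 0 μ) := by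
      intro μ
      simp only [Polynomial.eval_eq_sum_range]
      rw [integral_finsetSum]
      · simp only [integral_const_mul, integral_pow_spectralMeasure_J]
      · exact fun k _ => integrable_of_compl_Icc (hsupp μ) (by fun_prop)
    simp only [h]
    exact Finset.measurable_fun_sum _ fun k _ =>
      ((measurable_moment B k).comp (measurable_shift 0)).const_mul _
  · rw [tendsto_pi_nhds]
    intro μ
    rw [tendsto_iff_dist_tendsto_zero]
    exact squeeze_zero (fun _ => dist_nonneg) (fun n => abs_integral_sub_le_of_compl_Icc (hsupp μ)
      (q n).continuous hf fun x hx => (hq n x hx).le) tendsto_one_div_add_atTop_nhds_zero_nat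

theorem measurable_spectralMeasure_J (B : BlockSystem D) :
    Measurable fun μ => spectralMeasure (J B μ) (e 0) := by
  refine Measurable.measure_of_isPiSystem_of_isProbabilityMeasure (borel_eq_generateFrom_Iic ℝ)
    isPiSystem_Iic ?_
  rintro _ ⟨t, rfl⟩
  have hset : {x : ℝ | max (x - t) 0 = 0} = Set.Iic t := by
    ext x
    simp
  have h : ∀ μ, spectralMeasure (J B μ) (e 0) (Set.Iic t) =
      ENNReal.ofReal ((spectralMeasure (J B μ) (e 0)).real (Set.Iic t)) := fun μ =>
    (ofReal_measureReal (measure_ne_top _ _)).symm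
  simp only [h]
  refine ENNReal.measurable_ofReal.comp ?_
  refine measurable_of_tendsto_metrizable (f := fun (n : ℕ) μ =>
    ∫ x, max (1 - n * max (x - t) 0) 0 ∂(spectralMeasure (J B μ) (e 0))) (fun n => ?_) ?_
  · exact measurable_integral_spectralMeasure_J B (by fun_prop)
  · rw [tendsto_pi_nhds]
    intro μ
    have := tendsto_integral_measureReal_zeroSet (spectralMeasure (J B μ) (e 0))
      (g := fun x => max (x - t) 0) (by fun_prop) fun x => le_max_right _ _
    rwa [hset] at this

/-- The random Jacobi operator has no fixed point mass: along an orbit of the shift the masses of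
an energy `t` add up to at most the dimension of the eigenspace, which is at most two. -/
theorem lintegral_spectralMeasure_singleton (B : BlockSystem D) (p : PMF (Fin D)) (t : ℝ) :
    ∫⁻ μ, spectralMeasure (J B μ) (e 0) {t} ∂(resonatorLaw B p) = 0 := by
  set a := ∫⁻ μ, spectralMeasure (J B μ) (e 0) {t} ∂(resonatorLaw B p) with ha
  have hmeas : Measurable fun μ => spectralMeasure (J B μ) (e 0) {t} :=
    (Measure.measurable_coe (measurableSet_singleton t)).comp (measurable_spectralMeasure_J B)
  have hpres : ∀ i : ℕ,
      MeasurePreserving (shift (i : ℤ)) (resonatorLaw B p) (resonatorLaw B p) := by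
    intro i
    have h := (measurePreserving_shift_resonatorLaw B p).iterate i
    have e : (shift 1)^[i] = (shift (i : ℤ) : (ℤ → B.Index) → ℤ → B.Index) := by
      induction i with
      | zero => funext μ k; simp [shift]
      | succ i ih =>
        rw [Function.iterate_succ', ih ((measurePreserving_shift_resonatorLaw B p).iterate i)]
        funext μ
        exact (shift_shift _ _ _).trans (by push_cast; rfl)
    rwa [e] at h
  have hshift : ∀ i : ℕ, ∫⁻ μ, spectralMeasure (J B μ) (e i) {t} ∂(resonatorLaw B p) = a := by
    intro i
    rw [ha, ← (hpres i).lintegral_comp hmeas]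
    simp only [spectralMeasure_J_shift]
  have hmeas_i : ∀ i : ℕ, Measurable fun μ => spectralMeasure (J B μ) (e i) {t} := by
    intro i
    have := hmeas.comp (measurable_shift (i : ℤ))
    simpa only [Function.comp_def, spectralMeasure_J_shift] using this
  have hle : ∀ n : ℕ, n * a ≤ 2 := by
    intro n
    have h1 : (n : ℝ≥0∞) * a = ∫⁻ μ, ∑ i ∈ Finset.range n, spectralMeasure (J B μ) (e i) {t}
        ∂(resonatorLaw B p) := by
      rw [lintegral_finsetSum _ fun i _ => hmeas_i i]
      simp [hshift]
    have h2 : ∀ μ : ℤ → B.Index,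
        ∑ i ∈ Finset.range n, spectralMeasure (J B μ) (e i) {t} ≤ 2 := by
      intro μ
      obtain ⟨h3, h4⟩ := finiteDimensional_ker_jacobiOperator_sub
        (q := ⟨diagEntry B μ, memℓp_diagEntry B μ⟩)
        (s := ⟨offDiagEntry B μ, memℓp_offDiagEntry B μ⟩)
        (offDiagEntry_ne_zero B μ) t
      have h5 := sum_spectralMeasure_singleton_le (isSelfAdjoint_J B μ) t h3
        (orthonormal_e.comp (fun i : ℕ => (i : ℤ)) Nat.cast_injective) (Finset.range n)
      have h6 : ∑ i ∈ Finset.range n, (spectralMeasure (J B μ) (e i)).real {t} ≤ 2 :=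
        h5.trans (by exact_mod_cast h4)
      calc ∑ i ∈ Finset.range n, spectralMeasure (J B μ) (e i) {t}
          = ∑ i ∈ Finset.range n, ENNReal.ofReal ((spectralMeasure (J B μ) (e i)).real {t}) :=
            Finset.sum_congr rfl fun i _ => (ofReal_measureReal (measure_ne_top _ _)).symm
        _ = ENNReal.ofReal (∑ i ∈ Finset.range n, (spectralMeasure (J B μ) (e i)).real {t}) :=
            (ENNReal.ofReal_sum_of_nonneg fun _ _ => measureReal_nonneg).symm
        _ ≤ ENNReal.ofReal 2 := ENNReal.ofReal_le_ofReal h6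
        _ = 2 := by simp
    rw [h1]
    calc _ ≤ ∫⁻ _, 2 ∂(resonatorLaw B p) := lintegral_mono h2
      _ = 2 := by simp
  have hfin : a ≠ ∞ := by
    have := hle 1
    rw [Nat.cast_one, one_mul] at this
    exact ne_top_of_le_ne_top (by simp) this
  by_contra h
  have hpos : 0 < a.toReal := ENNReal.toReal_pos h hfin
  obtain ⟨n, hn⟩ := exists_nat_gt (2 / a.toReal)
  have h1 := ENNReal.toReal_mono (by simp) (hle n)
  rw [ENNReal.toReal_mul, ENNReal.toReal_natCast, ENNReal.toReal_ofNat] at h1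
  rw [div_lt_iff₀ hpos] at hn
  linarith

/-! ### The density of states -/

/-- The density of states: the mean of the spectral measure at the origin. -/
noncomputable def densityOfStates (B : BlockSystem D) (p : PMF (Fin D)) : Measure ℝ :=
  (resonatorLaw B p).bind fun μ => spectralMeasure (J B μ) (e 0)

theorem densityOfStates_apply (B : BlockSystem D) (p : PMF (Fin D)) {S : Set ℝ}
    (hS : MeasurableSet S) :
    densityOfStates B p S = ∫⁻ μ, spectralMeasure (J B μ) (e 0) S ∂(resonatorLaw B p) :=
  Measure.bind_apply hS (measurable_spectralMeasure_J B).aemeasurable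

instance (B : BlockSystem D) (p : PMF (Fin D)) : IsProbabilityMeasure (densityOfStates B p) :=
  ⟨by rw [densityOfStates_apply B p .univ]; simp⟩

theorem densityOfStates_compl_Icc (B : BlockSystem D) (p : PMF (Fin D)) {C : ℝ}
    (hC : ∀ (μ : ℤ → B.Index) (i : ℤ), |diagEntry B μ i| ≤ C ∧ |offDiagEntry B μ i| ≤ C) :
    densityOfStates B p (Set.Icc (-(3 * C)) (3 * C))ᶜ = 0 := by
  rw [densityOfStates_apply B p measurableSet_Icc.compl]
  simp [spectralMeasure_J_compl_Icc B hC]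

theorem integral_pow_densityOfStates (B : BlockSystem D) (p : PMF (Fin D)) (n : ℕ) :
    ∫ x, x ^ n ∂(densityOfStates B p) = ∫ μ, moment B n μ ∂(resonatorLaw B p) := by
  obtain ⟨C, -, hC⟩ := exists_bound_entries B
  let κ : ProbabilityTheory.Kernel (ℤ → B.Index) ℝ :=
    ⟨fun μ => spectralMeasure (J B μ) (e 0), measurable_spectralMeasure_J B⟩
  have hκ : densityOfStates B p =
      (κ.comp (ProbabilityTheory.Kernel.const Unit (resonatorLaw B p))) () := by
    rw [ProbabilityTheory.Kernel.comp_apply]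
    rfl
  have hint : Integrable (fun x : ℝ => x ^ n) (densityOfStates B p) :=
    integrable_of_compl_Icc (densityOfStates_compl_Icc B p hC) (by fun_prop)
  rw [hκ] at hint ⊢
  rw [ProbabilityTheory.Kernel.integral_comp hint, ProbabilityTheory.Kernel.const_apply]
  refine integral_congr_ae (Eventually.of_forall fun μ => ?_)
  have h : shift 0 μ = μ := by funext i; simp [shift]
  exact (integral_pow_spectralMeasure_J B μ 0 n).trans (by rw [h])

/-- The counting measures converge weakly as soon as the averages of all moments along the sequence
converge, because truncating only changes the diagonal of a power near the two ends. -/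
theorem tendsto_integral_countingMeasure (B : BlockSystem D) (p : PMF (Fin D)) {μ : ℤ → B.Index}
    (h : ∀ n : ℕ, Tendsto (windowAverage fun i => moment B n (shift i μ)) atTop
      (𝓝 (∫ μ, moment B n μ ∂(resonatorLaw B p)))) {f : ℝ → ℝ} (hf : Continuous f) :
    Tendsto (fun K : ℕ => ∫ x, f x ∂(countingMeasure (J B μ) K)) atTop
      (𝓝 (∫ x, f x ∂(densityOfStates B p))) := by
  obtain ⟨C, hC0, hC⟩ := exists_bound_entries B
  have : ∀ K, IsProbabilityMeasure (countingMeasure (J B μ) K) := fun K =>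
    isProbabilityMeasure_countingMeasure (offDiagEntry_ne_zero B μ)
  refine tendsto_integral_of_tendsto_moments (M := 3 * C)
    (ν := fun K => countingMeasure (J B μ) K)
    (fun K => countingMeasure_compl_Icc (fun i => (hC μ i).1) fun i => (hC μ i).2)
    (densityOfStates_compl_Icc B p hC) (fun n => ?_) hf
  rw [integral_pow_densityOfStates]
  have hbd : ∀ K : ℕ, |∫ x, x ^ n ∂(countingMeasure (J B μ) K) -
      windowAverage (fun i => moment B n (shift i μ)) K| ≤
        (4 * (n + 1) * (3 * C) ^ n) / ((2 * K + 1 : ℕ) : ℝ) := by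
    intro K
    have h1 := integral_pow_countingMeasure (K := K) (q := ⟨diagEntry B μ, memℓp_diagEntry B μ⟩)
      (s := ⟨offDiagEntry B μ, memℓp_offDiagEntry B μ⟩) (offDiagEntry_ne_zero B μ) n
    rw [J, h1, windowAverage, ← mul_sub, abs_mul, abs_of_nonneg (by positivity), inv_mul_eq_div]
    simp only [moment_shift]
    gcongr
    exact abs_trace_truncation_pow_sub_le (fun i => (hC μ i).1) (fun i => (hC μ i).2) n
  have hz : Tendsto (fun K : ℕ => (4 * (n + 1) * (3 * C) ^ n) / ((2 * K + 1 : ℕ) : ℝ)) atTop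
      (𝓝 0) := by
    refine tendsto_const_nhds.div_atTop (tendsto_natCast_atTop_atTop.comp ?_)
    exact tendsto_atTop_mono (fun K : ℕ => (by omega : K ≤ 2 * K + 1)) tendsto_id
  have := (squeeze_zero_norm hbd hz).add (h n)
  rw [zero_add] at this
  exact this.congr fun K => by ring

theorem continuous_measureReal_Iic {N : Measure ℝ} [IsProbabilityMeasure N]
    (hN : ∀ t, N {t} = 0) : Continuous fun t : ℝ => N.real (Set.Iic t) := by
  rw [continuous_iff_continuousAt]
  intro t
  have h : ∀ r, N.real (Set.Iic r) = ∫ x, (Set.Iic r).indicator (fun _ => (1 : ℝ)) x ∂N := by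
    intro r
    rw [integral_indicator measurableSet_Iic]
    simp
  simp only [ContinuousAt, h]
  refine tendsto_integral_filter_of_dominated_convergence (fun _ => 1)
    (Eventually.of_forall fun r =>
      (measurable_const.indicator measurableSet_Iic).aestronglyMeasurable)
    (Eventually.of_forall fun r => Eventually.of_forall fun x => ?_) (integrable_const _) ?_
  · exact (norm_indicator_le_norm_self _ _).trans (by simp)
  · have hne : ∀ᵐ x ∂N, x ≠ t := by simpa [ae_iff] using hN t
    filter_upwards [hne] with x hx
    refine tendsto_const_nhds.congr' ?_
    rcases lt_or_gt_of_ne hx with hx | hx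
    · filter_upwards [lt_mem_nhds hx] with r hr
      rw [Set.indicator_of_mem (Set.mem_Iic.2 hx.le), Set.indicator_of_mem (Set.mem_Iic.2 hr.le)]
    · filter_upwards [gt_mem_nhds hx] with r hr
      rw [Set.indicator_of_notMem (by simpa using hx), Set.indicator_of_notMem (by simpa using hr)]

end BlockJacobi

theorem mainTheorem1 {D : ℕ} (B : BlockJacobi.BlockSystem D) (p : PMF (Fin D)) :
    ∃ N : MeasureTheory.Measure ℝ, MeasureTheory.IsProbabilityMeasure N ∧
      (∀ᵐ μ ∂(BlockJacobi.resonatorLaw B p), ∀ f : ℝ →ᵇ ℝ,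
        Tendsto (fun K : ℕ => ∫ x, f x ∂(BlockJacobi.countingMeasure (BlockJacobi.J B μ) K)) atTop
          (𝓝 (∫ x, f x ∂N))) ∧
      (∀ᵐ χ ∂(BlockJacobi.blockLaw p), ∀ f : ℝ →ᵇ ℝ,
        Tendsto (fun K : ℕ => ∫ x, f x ∂(BlockJacobi.countingMeasure
          (BlockJacobi.J B (BlockJacobi.resonatorSequence B χ)) K)) atTop (𝓝 (∫ x, f x ∂N))) ∧
      (∀ S : Set ℝ, MeasurableSet S →
        AEMeasurable (fun μ => BlockJacobi.spectralMeasure (BlockJacobi.J B μ) (BlockJacobi.e 0) S)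
          (BlockJacobi.resonatorLaw B p) ∧
        N S = ∫⁻ μ, BlockJacobi.spectralMeasure (BlockJacobi.J B μ) (BlockJacobi.e 0) S
          ∂(BlockJacobi.resonatorLaw B p)) ∧
      Continuous fun t : ℝ => N.real (Set.Iic t) := by
  obtain ⟨C, -, hC⟩ := BlockJacobi.exists_bound_entries B
  refine ⟨BlockJacobi.densityOfStates B p, inferInstance, ?_, ?_, fun S hS => ⟨?_, ?_⟩, ?_⟩
  · filter_upwards [ae_all_iff.2 fun n => BlockJacobi.ae_resonatorLaw_tendsto_windowAverage B p
      (BlockJacobi.abs_moment_le B hC n) (BlockJacobi.moment_local B n)] with μ hμ f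
    exact BlockJacobi.tendsto_integral_countingMeasure B p hμ f.continuous
  · filter_upwards [ae_all_iff.2 fun n => BlockJacobi.ae_blockLaw_tendsto_windowAverage B p
      (BlockJacobi.abs_moment_le B hC n) (BlockJacobi.moment_local B n)] with χ hχ f
    exact BlockJacobi.tendsto_integral_countingMeasure B p hχ f.continuous
  · exact ((Measure.measurable_coe hS).comp
      (BlockJacobi.measurable_spectralMeasure_J B)).aemeasurable
  · exact BlockJacobi.densityOfStates_apply B p hS
  · refine BlockJacobi.continuous_measureReal_Iic fun t => ?_
    rw [BlockJacobi.densityOfStates_apply B p (measurableSet_singleton t)]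
    exact BlockJacobi.lintegral_spectralMeasure_singleton B p t
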